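/- Let $X$ be a deterministic real $n\times d$ matrix without zero columns, let $\beta_\star\in\mathbb R^d$, and let $Y = X\beta_\star+\varepsilon$, where the random vector $\varepsilon$ satisfies $\mathbb E[\varepsilon]=0$ and $\mathrm{Cov}(\varepsilon)=I_n$. Write $\mathbb X := X^\top X$ and, for $p\in(0,1)$, $\mathbb X_p := p\,\mathbb X+(1-p)\,\mathrm{Diag}(\mathbb X)$, where $\mathrm{Diag}(A)$ is the diagonal matrix with the same diagonal as $A$. Let $\|\cdot\|$ be the spectral norm and $\lambda_{\min}$ the smallest eigenvalue of a symmetric matrix; for symmetric matrices, $A\ge B$ means that $A-B$ is positive semi-definite. A $p$-dropout matrix is a random diagonal $d\times d$ matrix whose diagonal entries are i.i.d. $\mathrm{Ber}(p)$. Let $D_1,D_2,\dots$ be i.i.d. $p$-dropout matrices, let $\tilde\beta_0$ be a square integrable random vector in $\mathbb R^d$ that is independent of $Y$, and suppose that the sequence $(D_k)_{k\ge1}$ is independent of $(\tilde\beta_0,Y)$. For a learning rate $\alpha>0$, the iterates of gradient descent with dropout are $$\tilde\beta_{k+1} = \tilde\beta_k+\alpha D_{k+1}X^\top\bigl(Y-XD_{k+1}\tilde\beta_k\bigr),\qquad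 k=0,1,2,\dots$$ Let $\tilde\beta := \operatorname{argmin}_{\beta\in\mathbb R^d}\mathbb E\bigl[\|Y-XD\beta\|_2^2\mid Y\bigr]$ be the minimizer of the marginalized loss, where $D$ is a $p$-dropout matrix independent of $Y$. Assume that $$\alpha p\|\mathbb X\|<1,\qquad \alpha<\frac{\lambda_{\min}(\mathbb X_p)}{3\|\mathbb X\|^2},$$ and that for every $\ell=1,\dots,d$ there is some $m\ne\ell$ with $\mathbb X_{\ell m}\neq0$. Then the limit $\lim_{k\to\infty}\mathrm{Cov}(\tilde\beta_k)$ exists and $$\lim_{k\to\infty}\mathrm{Cov}(\tilde\beta_k)-\mathrm{Cov}(\tilde\beta)\;\ge\;\frac{\alpha p(1-p)^2\lambda_{\min}(\mathbb X)}{2\|\mathbb X\|^3}\,\min_{i\ne j:\,\mathbb X_{ij}\ne0}\mathbb X_{ij}^2\cdot I_d .$$ -/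

import Mathlib

open MeasureTheory ProbabilityTheory Filter Topology
open scoped Matrix

namespace Dropout

noncomputable section

/-- The Gram matrix `𝕏 = Xᵀ X` of a design matrix. -/
def gram {n d : ℕ} (X : Matrix (Fin n) (Fin d) ℝ) : Matrix (Fin d) (Fin d) ℝ := Xᵀ * X

/-- `A_p = p A + (1 - p) Diag(A)`. -/
def shrink {d : ℕ} (p : ℝ) (A : Matrix (Fin d) (Fin d) ℝ) : Matrix (Fin d) (Fin d) ℝ :=
  p • A + (1 - p) • Matrix.diagonal A.diag

/-- The spectral norm: the operator norm induced by the Euclidean norm. -/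
def spectralNorm {d : ℕ} (A : Matrix (Fin d) (Fin d) ℝ) : ℝ :=
  ‖Matrix.toEuclideanCLM (n := Fin d) (𝕜 := ℝ) A‖

/-- The smallest eigenvalue; only used for symmetric matrices, whose spectrum is real, finite,
and nonempty unless `d = 0`. -/
def lambdaMin {d : ℕ} (A : Matrix (Fin d) (Fin d) ℝ) : ℝ := sInf (spectrum ℝ A)

/-- `min_{i ≠ j, A_ij ≠ 0} A_ij²`. -/
def minOffDiagSq {d : ℕ} (A : Matrix (Fin d) (Fin d) ℝ) : ℝ :=
  sInf {x | ∃ i j, i ≠ j ∧ A i j ≠ 0 ∧ x = A i j ^ 2}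

/-- The covariance matrix of a random vector. -/
def covMat {Ω : Type*} [MeasurableSpace Ω] {m : ℕ} (Z : Ω → Fin m → ℝ) (P : Measure Ω) :
    Matrix (Fin m) (Fin m) ℝ :=
  Matrix.of fun i j => covariance (fun ω => Z ω i) (fun ω => Z ω j) P

/-- The law of the diagonal of a `p`-dropout matrix: `d` i.i.d. entries, equal to `1` with
probability `p` and to `0` with probability `1 - p`. -/
def dropoutLaw (d : ℕ) (p : unitInterval) : Measure (Fin d → ℝ) :=
  Measure.pi fun _ => bernoulliMeasure (1 : ℝ) 0 p

/-- The dropout gradient descent iterates, with learning rate `α`, response `y`, start `b₀` and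
step `b ↦ b + α D Xᵀ (y - X D b)`. Here `δ k` is the diagonal of the dropout matrix `D_{k+1}`
used to pass from the `k`-th to the `(k+1)`-st iterate. -/
def iterate {n d : ℕ} (X : Matrix (Fin n) (Fin d) ℝ) (α : ℝ) (y : Fin n → ℝ) (b₀ : Fin d → ℝ)
    (δ : ℕ → Fin d → ℝ) : ℕ → Fin d → ℝ
  | 0 => b₀
  | k + 1 =>
    iterate X α y b₀ δ k +
      α • (Matrix.diagonal (δ k) *ᵥ
        (Xᵀ *ᵥ (y - X *ᵥ (Matrix.diagonal (δ k) *ᵥ iterate X α y b₀ δ k))))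

/-- The marginalized loss `b ↦ E[‖Y - X D b‖₂² | Y = y]`, where the dropout matrix `D` is
independent of `Y`. -/
def marginalLoss {n d : ℕ} (X : Matrix (Fin n) (Fin d) ℝ) (p : unitInterval) (y : Fin n → ℝ)
    (b : Fin d → ℝ) : ℝ :=
  ∫ δ, (∑ i, (y i - (X *ᵥ (Matrix.diagonal δ *ᵥ b)) i) ^ 2) ∂(dropoutLaw d p)

/-- The minimizer of the marginalized loss. If `X` has no zero column and `0 < p < 1`, then the
loss is a strictly convex quadratic function of `b`, so there is exactly one minimizer. -/
def marginalMinimizer {n d : ℕ} (X : Matrix (Fin n) (Fin d) ℝ) (p : unitInterval)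
    (y : Fin n → ℝ) : Fin d → ℝ :=
  Classical.epsilon fun b => ∀ b', marginalLoss X p y b ≤ marginalLoss X p y b'

end

end Dropout

/-!
The distance `e k` of the `k`-th iterate to the minimizer `b` of the marginalized loss satisfies a
random affine recursion `e (k + 1) = Q e k + R b`. Here `Q = 1 - α D 𝕏 D` contracts in mean square,
because `E[Q Qᵀ] ≤ 1 - α p (2 λ_min(𝕏_p) - α ‖𝕏‖²)`, while `R = α D (𝕏_p - 𝕏 D)` has mean zero.
Hence `e k` becomes uncorrelated with `b`, and the covariances of the iterates converge to
`M + Cov b`, where `M` solves the stationary equation `M = E[Q M Qᵀ] + E[R S Rᵀ]` with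
`S = E[b bᵀ]`.

The fluctuations of `D` never vanish: every column of `𝕏` has a nonzero off-diagonal entry, so
`E[R Rᵀ]`, and with it `E[R S Rᵀ]`, is bounded below by a multiple `c` of the identity. Since
`E[Q Qᵀ] ≥ 1 - θ` for `θ = 2 α p ‖𝕏‖`, evaluating the stationary equation at the smallest eigenvalue
of `M` gives `M ≥ c / θ`.
-/

namespace Dropout

noncomputable section

section Loewner

open scoped MatrixOrder Matrix.Norms.L2Operator

variable {m n : Type*} {A B : Matrix n n ℝ}

section

variable [DecidableEq n]

lemma isHermitian_smul_one (c : ℝ) : (c • (1 : Matrix n n ℝ)).IsHermitian := by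
  simp [Matrix.IsHermitian]

lemma posDef_of_smul_one_le {c : ℝ} (hc : 0 < c) (h : c • 1 ≤ A) : A.PosDef := by
  have := Matrix.PosDef.add_posSemidef (Matrix.PosDef.one.smul hc) (Matrix.le_iff.1 h)
  rwa [add_sub_cancel] at this

lemma smul_one_le_smul_one {a b : ℝ} (h : a ≤ b) :
    a • (1 : Matrix n n ℝ) ≤ b • (1 : Matrix n n ℝ) := by
  rw [Matrix.le_iff, ← sub_smul]
  exact Matrix.PosSemidef.one.smul (sub_nonneg.2 h)

end

variable [Fintype n]

lemma le_of_dotProduct_mulVec_le (hA : A.IsHermitian) (hB : B.IsHermitian)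
    (h : ∀ v, v ⬝ᵥ A *ᵥ v ≤ v ⬝ᵥ B *ᵥ v) : A ≤ B :=
  Matrix.le_iff.2 <| .of_dotProduct_mulVec_nonneg (hB.sub hA) fun v => by
    simpa [Matrix.sub_mulVec] using h v

lemma dotProduct_mulVec_mono (h : A ≤ B) (v : n → ℝ) : v ⬝ᵥ A *ᵥ v ≤ v ⬝ᵥ B *ᵥ v := by
  simpa [Matrix.sub_mulVec] using (Matrix.le_iff.1 h).dotProduct_mulVec_nonneg v

lemma mul_mul_transpose_mono [Finite m] (Q : Matrix m n ℝ) (h : A ≤ B) :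
    Q * A * Qᵀ ≤ Q * B * Qᵀ := by
  simpa [Matrix.le_iff, Matrix.mul_sub, Matrix.sub_mul] using
    (Matrix.le_iff.1 h).mul_mul_conjTranspose_same Q

lemma dotProduct_mul_transpose_self_mulVec [Fintype m] (Q : Matrix m n ℝ) (v : m → ℝ) :
    v ⬝ᵥ (Q * Qᵀ) *ᵥ v = (Qᵀ *ᵥ v) ⬝ᵥ (Qᵀ *ᵥ v) := by
  rw [← Matrix.mulVec_mulVec, Matrix.dotProduct_mulVec, Matrix.mulVec_transpose]

lemma norm_toLp_sq (v : n → ℝ) : ‖WithLp.toLp 2 v‖ ^ 2 = v ⬝ᵥ v := by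
  rw [EuclideanSpace.real_norm_sq_eq]
  simp [dotProduct, sq]

variable [DecidableEq n]

lemma dotProduct_smul_one_mulVec (c : ℝ) (v : n → ℝ) :
    v ⬝ᵥ (c • (1 : Matrix n n ℝ)) *ᵥ v = c * (v ⬝ᵥ v) := by
  simp [Matrix.smul_mulVec]

lemma dotProduct_mulVec_le_norm_mul (A : Matrix n n ℝ) (u v : n → ℝ) :
    u ⬝ᵥ A *ᵥ v ≤ ‖A‖ * ((u ⬝ᵥ u + v ⬝ᵥ v) / 2) := by
  let T := Matrix.toEuclideanCLM (n := n) (𝕜 := ℝ) A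
  let x := WithLp.toLp 2 u
  let y := WithLp.toLp 2 v
  calc u ⬝ᵥ A *ᵥ v = inner ℝ x (T y) := (Matrix.inner_toEuclideanCLM A x y).symm
    _ ≤ ‖x‖ * ‖T y‖ := real_inner_le_norm _ _
    _ ≤ ‖x‖ * (‖A‖ * ‖y‖) := by gcongr; exact T.le_opNorm y
    _ = ‖A‖ * (‖x‖ * ‖y‖) := by ring
    _ ≤ ‖A‖ * ((‖x‖ ^ 2 + ‖y‖ ^ 2) / 2) := by gcongr; linarith [two_mul_le_add_sq ‖x‖ ‖y‖]
    _ = ‖A‖ * ((u ⬝ᵥ u + v ⬝ᵥ v) / 2) := by rw [norm_toLp_sq, norm_toLp_sq]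

lemma norm_le_of_dotProduct_mulVec_le {C : ℝ} (hC : 0 ≤ C)
    (h : ∀ u v, u ⬝ᵥ u = 1 → v ⬝ᵥ v = 1 → u ⬝ᵥ A *ᵥ v ≤ C) : ‖A‖ ≤ C := by
  have dotProduct_eq_one (x : EuclideanSpace ℝ n) (hx : ‖x‖ = 1) : x.ofLp ⬝ᵥ x.ofLp = 1 := by
    rw [← norm_toLp_sq, WithLp.toLp_ofLp, hx, one_pow]
  refine ContinuousLinearMap.opNorm_le_of_re_inner_le
    (T := Matrix.toEuclideanCLM (n := n) (𝕜 := ℝ) A) hC fun x y hx hy => ?_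
  rw [real_inner_comm, Matrix.inner_toEuclideanCLM]
  exact h y x (dotProduct_eq_one y hy) (dotProduct_eq_one x hx)

lemma le_norm_smul_one (hA : A.IsHermitian) : A ≤ ‖A‖ • 1 :=
  le_of_dotProduct_mulVec_le hA (isHermitian_smul_one _) fun v => by
    simpa [dotProduct_smul_one_mulVec] using dotProduct_mulVec_le_norm_mul A v v

lemma mul_transpose_self_le (A : Matrix n n ℝ) : A * Aᵀ ≤ ‖A‖ ^ 2 • 1 := by
  have h := le_norm_smul_one (A := A * Aᵀ) (Matrix.isHermitian_mul_conjTranspose_self A)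
  rwa [← Matrix.conjTranspose_eq_transpose_of_trivial, ← Matrix.star_eq_conjTranspose,
    CStarRing.norm_self_mul_star, ← sq] at h

lemma abs_diag_le_norm (A : Matrix n n ℝ) (i : n) : |A i i| ≤ ‖A‖ := by
  refine abs_le'.2 ⟨?_, ?_⟩
  · simpa using dotProduct_mulVec_le_norm_mul A (Pi.single i 1) (Pi.single i 1)
  · simpa [Matrix.neg_mulVec] using
      dotProduct_mulVec_le_norm_mul (-A) (Pi.single i 1) (Pi.single i 1)

end Loewner

section Spectrum

open scoped MatrixOrder Matrix.Norms.L2Operator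

variable {d : ℕ} {A : Matrix (Fin d) (Fin d) ℝ}

lemma spectralNorm_eq_norm (A : Matrix (Fin d) (Fin d) ℝ) : spectralNorm A = ‖A‖ := rfl

lemma smul_one_le_iff_spectrum (hA : A.IsHermitian) {c : ℝ} :
    c • 1 ≤ A ↔ ∀ x ∈ spectrum ℝ A, c ≤ x := by
  rw [Matrix.le_iff, Matrix.posSemidef_iff_isHermitian_and_spectrum_nonneg,
    and_iff_right (hA.sub (isHermitian_smul_one c)), ← Algebra.algebraMap_eq_smul_one,
    ← spectrum.sub_singleton_eq]
  simp [Set.subset_def]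

lemma lambdaMin_smul_one_le (hA : A.IsHermitian) : lambdaMin A • 1 ≤ A := by
  refine (smul_one_le_iff_spectrum hA).2 fun x hx => csInf_le ?_ hx
  rw [hA.spectrum_real_eq_range_eigenvalues]
  exact (Set.finite_range _).bddBelow

lemma le_lambdaMin [NeZero d] (hA : A.IsHermitian) {c : ℝ} (h : c • 1 ≤ A) : c ≤ lambdaMin A := by
  refine le_csInf ?_ ((smul_one_le_iff_spectrum hA).1 h)
  rw [hA.spectrum_real_eq_range_eigenvalues]
  exact Set.range_nonempty _

lemma lambdaMin_nonneg (hA : 0 ≤ A) : 0 ≤ lambdaMin A := by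
  rw [Matrix.nonneg_iff_posSemidef, Matrix.posSemidef_iff_isHermitian_and_spectrum_nonneg] at hA
  exact Real.sInf_nonneg fun _ hx => hA.2 hx

lemma minOffDiagSq_le {i j : Fin d} (hij : i ≠ j) (hA : A i j ≠ 0) :
    minOffDiagSq A ≤ A i j ^ 2 := by
  refine csInf_le ⟨0, ?_⟩ ⟨i, j, hij, hA, rfl⟩
  rintro _ ⟨i, j, -, -, rfl⟩
  positivity

lemma gram_nonneg {n : ℕ} (X : Matrix (Fin n) (Fin d) ℝ) : 0 ≤ gram X := by
  simpa [gram] using (Matrix.posSemidef_conjTranspose_mul_self X).nonneg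

lemma transpose_gram {n : ℕ} (X : Matrix (Fin n) (Fin d) ℝ) : (gram X)ᵀ = gram X := by
  simp [gram]

lemma shrink_apply (p : ℝ) (A : Matrix (Fin d) (Fin d) ℝ) (i j : Fin d) :
    shrink p A i j = if i = j then A i i else p * A i j := by
  rcases eq_or_ne i j with rfl | hij
  · simp [shrink]; ring
  · simp [shrink, hij]

lemma transpose_shrink (p : ℝ) (A : Matrix (Fin d) (Fin d) ℝ) : (shrink p A)ᵀ = shrink p Aᵀ := by
  simp [shrink]

lemma norm_shrink_le (p : unitInterval) (A : Matrix (Fin d) (Fin d) ℝ) : ‖shrink p A‖ ≤ ‖A‖ := by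
  have hdiag : ‖Matrix.diagonal A.diag‖ ≤ ‖A‖ := by
    rw [Matrix.l2_opNorm_diagonal, pi_norm_le_iff_of_nonneg (norm_nonneg A)]
    exact abs_diag_le_norm A
  calc ‖shrink p A‖ ≤ ‖(p : ℝ) • A‖ + ‖(1 - p : ℝ) • Matrix.diagonal A.diag‖ := norm_add_le _ _
    _ = p * ‖A‖ + (1 - p) * ‖Matrix.diagonal A.diag‖ := by
        rw [norm_smul, norm_smul, Real.norm_of_nonneg p.2.1, Real.norm_of_nonneg (by simp [p.2.2])]
    _ ≤ p * ‖A‖ + (1 - p) * ‖A‖ := by gcongr; simp [p.2.2]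
    _ = ‖A‖ := by ring

end Spectrum

section FinitelySupported

/-- A measure carried by a finite set: every function is then integrable, measurable or not, so
that expectations over a dropout mask need no side conditions. -/
def FinitelySupported {κ : Type*} [MeasurableSpace κ] (μ : Measure κ) : Prop :=
  ∃ s : Finset κ, ∀ᵐ x ∂μ, x ∈ s

variable {κ E : Type*} [MeasurableSpace κ] [MeasurableSingletonClass κ] [NormedAddCommGroup E]
  {μ : Measure κ} [IsFiniteMeasure μ]

lemma FinitelySupported.memLp (hμ : FinitelySupported μ) (f : κ → E) (q : ENNReal) :
    MemLp f q μ := by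
  classical
  obtain ⟨s, hs⟩ := hμ
  have hsum : MemLp (fun x => ∑ y ∈ s, ({y} : Set κ).indicator (fun _ => f y) x) q μ :=
    memLp_finsetSum _ fun y _ =>
      memLp_indicator_const q (measurableSet_singleton y) (f y) (.inr (measure_ne_top μ _))
  refine hsum.ae_eq ?_
  filter_upwards [hs] with x hx
  simp [Set.indicator_apply, hx]

lemma FinitelySupported.integrable (hμ : FinitelySupported μ) (f : κ → E) : Integrable f μ :=
  memLp_one_iff_integrable.1 (hμ.memLp f 1)

end FinitelySupported

section MatrixIntegral

open scoped MatrixOrder Matrix.Norms.L2Operator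

instance instClosedIciTopologyMatrix {n : Type*} [Finite n] :
    ClosedIciTopology (Matrix n n ℝ) where
  isClosed_Ici M := by
    have := Fintype.ofFinite n
    have hset : Set.Ici M = {A | Aᵀ - Mᵀ = A - M} ∩ ⋂ v, {A | 0 ≤ v ⬝ᵥ (A - M) *ᵥ v} := by
      ext A
      simp [Matrix.le_iff, Matrix.posSemidef_iff_dotProduct_mulVec, Matrix.IsHermitian]
    rw [hset]
    exact (isClosed_eq (by fun_prop) (by fun_prop)).inter <|
      isClosed_iInter fun v => isClosed_le continuous_const (by fun_prop)

variable {κ n : Type*} [MeasurableSpace κ] {μ : Measure κ} [Fintype n] [DecidableEq n]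

lemma integral_matrix_apply {F : κ → Matrix n n ℝ} (hF : Integrable F μ) (i j : n) :
    (∫ x, F x ∂μ) i j = ∫ x, F x i j ∂μ :=
  ((Matrix.entryLinearMap ℝ ℝ i j).toContinuousLinearMap.integral_comp_comm hF).symm

lemma dotProduct_integral_mulVec {F : κ → Matrix n n ℝ} (hF : Integrable F μ) (v w : n → ℝ) :
    v ⬝ᵥ (∫ x, F x ∂μ) *ᵥ w = ∫ x, v ⬝ᵥ F x *ᵥ w ∂μ := by
  let φ : Matrix n n ℝ →ₗ[ℝ] ℝ :=
    (dotProductBilin ℝ ℝ v).comp ((Matrix.mulVecBilin ℝ ℝ).flip w)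
  exact (φ.toContinuousLinearMap.integral_comp_comm hF).symm

lemma dotProduct_integral_mul_transpose_self_mulVec {U : κ → Matrix n n ℝ}
    (hU : Integrable (fun x => U x * (U x)ᵀ) μ) (v : n → ℝ) :
    v ⬝ᵥ (∫ x, U x * (U x)ᵀ ∂μ) *ᵥ v = ∫ x, ((U x)ᵀ *ᵥ v) ⬝ᵥ ((U x)ᵀ *ᵥ v) ∂μ := by
  rw [dotProduct_integral_mulVec hU]
  simp only [dotProduct_mul_transpose_self_mulVec]

lemma integral_mul_smul_one_mul_transpose (U : κ → Matrix n n ℝ) (c : ℝ) :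
    ∫ x, U x * (c • 1) * (U x)ᵀ ∂μ = c • ∫ x, U x * (U x)ᵀ ∂μ := by
  simp [integral_smul]

variable [MeasurableSingletonClass κ] [IsFiniteMeasure μ] {U V : κ → Matrix n n ℝ} {a b : ℝ}

lemma integral_dotProduct_transpose_mulVec_le (hμ : FinitelySupported μ)
    (hU : ∫ x, U x * (U x)ᵀ ∂μ ≤ a • 1) (v : n → ℝ) :
    ∫ x, ((U x)ᵀ *ᵥ v) ⬝ᵥ ((U x)ᵀ *ᵥ v) ∂μ ≤ a * (v ⬝ᵥ v) := by
  rw [← dotProduct_integral_mul_transpose_self_mulVec (hμ.integrable _),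
    ← dotProduct_smul_one_mulVec]
  exact dotProduct_mulVec_mono hU v

lemma nonneg_of_integral_mul_transpose_self_le [Nonempty n] (hμ : FinitelySupported μ)
    (hU : ∫ x, U x * (U x)ᵀ ∂μ ≤ a • 1) : 0 ≤ a := by
  obtain ⟨i⟩ := ‹Nonempty n›
  simpa using (integral_nonneg fun x => dotProduct_star_self_nonneg _).trans
    (integral_dotProduct_transpose_mulVec_le hμ hU (Pi.single i 1))

-- Cauchy–Schwarz and AM–GM, pointwise: `2 ⟨Uᵀu, M Vᵀv⟩ ≤ ‖M‖ (‖Uᵀu‖² + ‖Vᵀv‖²)`.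
lemma norm_integral_mul_mul_transpose_le [Nonempty n] (hμ : FinitelySupported μ)
    (hU : ∫ x, U x * (U x)ᵀ ∂μ ≤ a • 1) (hV : ∫ x, V x * (V x)ᵀ ∂μ ≤ b • 1) (M : Matrix n n ℝ) :
    ‖∫ x, U x * M * (V x)ᵀ ∂μ‖ ≤ (a + b) / 2 * ‖M‖ := by
  have ha : 0 ≤ a := nonneg_of_integral_mul_transpose_self_le hμ hU
  have hb : 0 ≤ b := nonneg_of_integral_mul_transpose_self_le hμ hV
  have unit_bound (W : κ → Matrix n n ℝ) {c : ℝ} (hW : ∫ x, W x * (W x)ᵀ ∂μ ≤ c • 1)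
      {v : n → ℝ} (hv : v ⬝ᵥ v = 1) : ∫ x, ((W x)ᵀ *ᵥ v) ⬝ᵥ ((W x)ᵀ *ᵥ v) ∂μ ≤ c := by
    simpa [hv] using integral_dotProduct_transpose_mulVec_le hμ hW v
  refine norm_le_of_dotProduct_mulVec_le
    (mul_nonneg (div_nonneg (add_nonneg ha hb) zero_le_two) (norm_nonneg M)) fun u v hu hv => ?_
  calc u ⬝ᵥ (∫ x, U x * M * (V x)ᵀ ∂μ) *ᵥ v
      = ∫ x, ((U x)ᵀ *ᵥ u) ⬝ᵥ M *ᵥ ((V x)ᵀ *ᵥ v) ∂μ := by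
        rw [dotProduct_integral_mulVec (hμ.integrable _)]
        simp only [← Matrix.mulVec_mulVec, Matrix.dotProduct_mulVec u, Matrix.mulVec_transpose]
    _ ≤ ∫ x, ‖M‖ * ((((U x)ᵀ *ᵥ u) ⬝ᵥ ((U x)ᵀ *ᵥ u) +
          ((V x)ᵀ *ᵥ v) ⬝ᵥ ((V x)ᵀ *ᵥ v)) / 2) ∂μ :=
        integral_mono (hμ.integrable _) (hμ.integrable _) fun x =>
          dotProduct_mulVec_le_norm_mul M _ _
    _ = ‖M‖ * ((∫ x, ((U x)ᵀ *ᵥ u) ⬝ᵥ ((U x)ᵀ *ᵥ u) ∂μ +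
          ∫ x, ((V x)ᵀ *ᵥ v) ⬝ᵥ ((V x)ᵀ *ᵥ v) ∂μ) / 2) := by
        rw [integral_const_mul, integral_div, integral_add (hμ.integrable _) (hμ.integrable _)]
    _ ≤ ‖M‖ * ((a + b) / 2) := by
        gcongr
        exacts [unit_bound U hU hu, unit_bound V hV hv]
    _ = (a + b) / 2 * ‖M‖ := mul_comm _ _

lemma integral_mul_mul_transpose_mono (hμ : FinitelySupported μ) {M N : Matrix n n ℝ}
    (h : M ≤ N) : ∫ x, U x * M * (U x)ᵀ ∂μ ≤ ∫ x, U x * N * (U x)ᵀ ∂μ :=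
  integral_mono (hμ.integrable _) (hμ.integrable _) fun x => mul_mul_transpose_mono (U x) h

end MatrixIntegral

section AffineRecursion

lemma tendsto_zero_of_le_mul_add {b g : ℕ → ℝ} {ρ : ℝ} (hρ0 : 0 ≤ ρ) (hρ1 : ρ < 1)
    (hb : ∀ k, 0 ≤ b k) (hg : Tendsto g atTop (𝓝 0))
    (hstep : ∀ k, b (k + 1) ≤ ρ * b k + g k) : Tendsto b atTop (𝓝 0) := by
  refine tendsto_order.2 ⟨fun ε hε => .of_forall fun k => hε.trans_le (hb k), fun ε hε => ?_⟩
  have hε' : 0 < ε / 2 * (1 - ρ) := mul_pos (half_pos hε) (sub_pos.2 hρ1)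
  obtain ⟨K, hK⟩ := eventually_atTop.1 (hg.eventually_lt_const hε')
  have bound (j : ℕ) : b (j + K) ≤ ε / 2 + ρ ^ j * b K := by
    induction j with
    | zero => simpa using (half_pos hε).le
    | succ j ih =>
      calc b (j + 1 + K) = b (j + K + 1) := by rw [add_right_comm]
        _ ≤ ρ * b (j + K) + g (j + K) := hstep _
        _ ≤ ρ * (ε / 2 + ρ ^ j * b K) + ε / 2 * (1 - ρ) := by
            gcongr; exact (hK _ (Nat.le_add_left K j)).le
        _ = ε / 2 + ρ ^ (j + 1) * b K := by ring
  have hpow : Tendsto (fun j => ρ ^ j * b K) atTop (𝓝 0) := by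
    simpa using (tendsto_pow_atTop_nhds_zero_of_lt_one hρ0 hρ1).mul_const (b K)
  obtain ⟨J, hJ⟩ := eventually_atTop.1 (hpow.eventually_lt_const (half_pos hε))
  filter_upwards [eventually_ge_atTop (J + K)] with k hk
  obtain ⟨j, rfl⟩ := Nat.exists_eq_add_of_le' (le_of_add_le_right hk)
  linarith [bound j, hJ j (le_of_add_le_add_right hk)]

variable {E : Type*} [NormedAddCommGroup E] [NormedSpace ℝ E] {T : E →L[ℝ] E} {x f : ℕ → E}

lemma tendsto_zero_of_affine_recursion (hT : ‖T‖ < 1) (hf : Tendsto f atTop (𝓝 0))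
    (hstep : ∀ k, x (k + 1) = T (x k) + f k) : Tendsto x atTop (𝓝 0) :=
  tendsto_zero_iff_norm_tendsto_zero.2 <|
    tendsto_zero_of_le_mul_add (norm_nonneg T) hT (fun _ => norm_nonneg _)
      (tendsto_zero_iff_norm_tendsto_zero.1 hf) fun k => by
      rw [hstep]
      exact norm_add_le_of_le (T.le_opNorm _) le_rfl

lemma exists_fixedPoint_tendsto [CompleteSpace E] (hT : ‖T‖ < 1) {f₀ : E}
    (hf : Tendsto f atTop (𝓝 f₀)) (hstep : ∀ k, x (k + 1) = T (x k) + f k) :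
    ∃ x₀, x₀ = T x₀ + f₀ ∧ Tendsto x atTop (𝓝 x₀) := by
  obtain ⟨u, hu⟩ := isUnit_one_sub_of_norm_lt_one hT
  let x₀ := (↑u⁻¹ : E →L[ℝ] E) f₀
  have hx₀ : x₀ - T x₀ = f₀ := by
    have := DFunLike.congr_fun u.mul_inv f₀
    rwa [hu] at this
  refine ⟨x₀, sub_eq_iff_eq_add'.1 hx₀, tendsto_sub_nhds_zero_iff.1 ?_⟩
  refine tendsto_zero_of_affine_recursion hT (tendsto_sub_nhds_zero_iff.2 hf) fun k => ?_
  rw [hstep, map_sub, ← hx₀]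
  abel

end AffineRecursion

section FixedPoint

open scoped MatrixOrder Matrix.Norms.L2Operator

-- Comparing `M` with `λ • 1` for `λ = lambdaMin M` gives `λ ≥ (1 - θ) λ + c`.
lemma smul_one_le_of_eq_integral_add {κ : Type*} [MeasurableSpace κ] [MeasurableSingletonClass κ]
    {μ : Measure κ} [IsFiniteMeasure μ] (hμ : FinitelySupported μ) {d : ℕ} [NeZero d]
    {Q : κ → Matrix (Fin d) (Fin d) ℝ} {M F : Matrix (Fin d) (Fin d) ℝ} {c θ : ℝ} (hθ : 0 < θ)
    (hM : 0 ≤ M) (hfix : M = ∫ x, Q x * M * (Q x)ᵀ ∂μ + F) (hF : c • 1 ≤ F)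
    (hQ : (1 - θ) • 1 ≤ ∫ x, Q x * (Q x)ᵀ ∂μ) : (c / θ) • 1 ≤ M := by
  have hherm : M.IsHermitian := (Matrix.nonneg_iff_posSemidef.1 hM).isHermitian
  have hstep : (lambdaMin M * (1 - θ) + c) • 1 ≤ M :=
    calc (lambdaMin M * (1 - θ) + c) • (1 : Matrix (Fin d) (Fin d) ℝ)
        = lambdaMin M • (1 - θ) • 1 + c • 1 := by rw [add_smul, mul_smul]
      _ ≤ lambdaMin M • (∫ x, Q x * (Q x)ᵀ ∂μ) + F :=
          add_le_add (smul_le_smul_of_nonneg_left hQ (lambdaMin_nonneg hM)) hF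
      _ = ∫ x, Q x * (lambdaMin M • 1) * (Q x)ᵀ ∂μ + F := by
          rw [integral_mul_smul_one_mul_transpose]
      _ ≤ ∫ x, Q x * M * (Q x)ᵀ ∂μ + F := by
          grw [integral_mul_mul_transpose_mono hμ (lambdaMin_smul_one_le hherm)]
      _ = M := hfix.symm
  have hle : c / θ ≤ lambdaMin M := by
    rw [div_le_iff₀ hθ]
    linarith [le_lambdaMin hherm hstep]
  exact (smul_one_le_smul_one hle).trans (lambdaMin_smul_one_le hherm)

end FixedPoint

section SecondMoments

open scoped MatrixOrder Matrix.Norms.L2Operator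

variable {Ω κ n : Type*} [MeasurableSpace Ω] [MeasurableSpace κ] {P : Measure Ω} {μ : Measure κ}
  [Fintype n] [DecidableEq n]

/-- The matrix `E[U Vᵀ]` of mixed second moments of two random vectors. -/
def crossMoment (U V : Ω → n → ℝ) (P : Measure Ω) : Matrix n n ℝ :=
  ∫ ω, Matrix.vecMulVec (U ω) (V ω) ∂P

/-- The averaged two-sided multiplication `N ↦ ∫ Q N Rᵀ dμ`. It describes how the second moments
of two random vectors change under multiplication by independent random matrices `Q` and `R`. -/
def averagedConj (μ : Measure κ) (Q R : κ → Matrix n n ℝ) : Matrix n n ℝ →L[ℝ] Matrix n n ℝ :=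
  ∫ x, ContinuousLinearMap.mulLeftRight ℝ (Matrix n n ℝ) (Q x) (R x)ᵀ ∂μ

section Moments

variable {U U' V : Ω → n → ℝ}

lemma integrable_vecMulVec (hU : MemLp U 2 P) (hV : MemLp V 2 P) :
    Integrable (fun ω => Matrix.vecMulVec (U ω) (V ω)) P :=
  let B : (n → ℝ) →ₗ[ℝ] (n → ℝ) →ₗ[ℝ] Matrix n n ℝ := vecMulVecBilin ℝ ℝ
  memLp_one_iff_integrable.1 (B.toContinuousBilinearMap.memLp_of_bilin 1 hU hV)

lemma crossMoment_apply (hU : MemLp U 2 P) (hV : MemLp V 2 P) (i j : n) :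
    crossMoment U V P i j = ∫ ω, U ω i * V ω j ∂P :=
  integral_matrix_apply (integrable_vecMulVec hU hV) i j

lemma transpose_crossMoment (hU : MemLp U 2 P) (hV : MemLp V 2 P) :
    (crossMoment U V P)ᵀ = crossMoment V U P := by
  ext i j
  simp only [Matrix.transpose_apply, crossMoment_apply hU hV, crossMoment_apply hV hU, mul_comm]

lemma crossMoment_add_left (hU : MemLp U 2 P) (hU' : MemLp U' 2 P) (hV : MemLp V 2 P) :
    crossMoment (U + U') V P = crossMoment U V P + crossMoment U' V P := by
  simp only [crossMoment, Pi.add_apply, Matrix.add_vecMulVec]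
  exact integral_add (integrable_vecMulVec hU hV) (integrable_vecMulVec hU' hV)

lemma crossMoment_add_right (hV : MemLp V 2 P) (hU : MemLp U 2 P) (hU' : MemLp U' 2 P) :
    crossMoment V (U + U') P = crossMoment V U P + crossMoment V U' P := by
  simp only [crossMoment, Pi.add_apply, Matrix.vecMulVec_add]
  exact integral_add (integrable_vecMulVec hV hU) (integrable_vecMulVec hV hU')

lemma crossMoment_self_nonneg (U : Ω → n → ℝ) : 0 ≤ crossMoment U U P :=
  integral_nonneg fun ω => (Matrix.posSemidef_vecMulVec_self_star (U ω)).nonneg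

end Moments

variable [MeasurableSingletonClass κ] [IsFiniteMeasure μ] {Q R : κ → Matrix n n ℝ}

lemma averagedConj_apply (hμ : FinitelySupported μ) (N : Matrix n n ℝ) :
    averagedConj μ Q R N = ∫ x, Q x * N * (R x)ᵀ ∂μ :=
  ContinuousLinearMap.integral_apply (hμ.integrable _) N

lemma norm_averagedConj_le [Nonempty n] (hμ : FinitelySupported μ) {a b : ℝ}
    (hQ : ∫ x, Q x * (Q x)ᵀ ∂μ ≤ a • 1) (hR : ∫ x, R x * (R x)ᵀ ∂μ ≤ b • 1) :
    ‖averagedConj μ Q R‖ ≤ (a + b) / 2 := by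
  have ha : 0 ≤ a := nonneg_of_integral_mul_transpose_self_le hμ hQ
  have hb : 0 ≤ b := nonneg_of_integral_mul_transpose_self_le hμ hR
  refine ContinuousLinearMap.opNorm_le_bound _ (by positivity) fun N => ?_
  rw [averagedConj_apply hμ]
  exact norm_integral_mul_mul_transpose_le hμ hQ hR N

variable {D : Ω → κ} {U V : Ω → n → ℝ}

lemma memLp_mulVec {l m : Type*} [Fintype l] [Fintype m] {Q : κ → Matrix m l ℝ} {U : Ω → l → ℝ}
    (hμ : FinitelySupported μ) (hD : HasLaw D μ P) (hU : MemLp U 2 P) :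
    MemLp (fun ω => Q (D ω) *ᵥ U ω) 2 P := by
  classical
  have hQ : MemLp (fun ω => Q (D ω)) ⊤ P :=
    (memLp_map_measure_iff (hD.map_eq ▸ (hμ.memLp Q ⊤).1) hD.aemeasurable).1
      (hD.map_eq ▸ hμ.memLp Q ⊤)
  exact (Matrix.mulVecBilin ℝ ℝ).toContinuousBilinearMap.memLp_of_bilin 2 hQ hU

lemma crossMoment_mulVec_mulVec (hμ : FinitelySupported μ) (hD : HasLaw D μ P)
    (hU : MemLp U 2 P) (hV : MemLp V 2 P) (hind : IndepFun D (fun ω => (U ω, V ω)) P) :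
    crossMoment (fun ω => Q (D ω) *ᵥ U ω) (fun ω => R (D ω) *ᵥ V ω) P =
      averagedConj μ Q R (crossMoment U V P) := by
  let L (x : κ) := ContinuousLinearMap.mulLeftRight ℝ (Matrix n n ℝ) (Q x) (R x)ᵀ
  let g (w : (n → ℝ) × (n → ℝ)) : Matrix n n ℝ := Matrix.vecMulVec w.1 w.2
  have hW : AEMeasurable (fun ω => (U ω, V ω)) P := hU.1.aemeasurable.prodMk hV.1.aemeasurable
  have hg : Integrable g (P.map fun ω => (U ω, V ω)) :=
    (integrable_map_measure (by fun_prop) hW).2 (integrable_vecMulVec hU hV)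
  have hL : Integrable L (P.map D) := hD.map_eq ▸ hμ.integrable L
  have hfactor : ∫ ω, L (D ω) (g (U ω, V ω)) ∂P = (∫ ω, L (D ω) ∂P) (∫ ω, g (U ω, V ω) ∂P) :=
    hind.integral_bilin_comp_comp hD.aemeasurable hW hL hg (ContinuousLinearMap.id ℝ _)
  have hmean : ∫ ω, L (D ω) ∂P = averagedConj μ Q R := hD.integral_comp (hμ.integrable L).1
  calc ∫ ω, Matrix.vecMulVec (Q (D ω) *ᵥ U ω) (R (D ω) *ᵥ V ω) ∂P
      = ∫ ω, L (D ω) (g (U ω, V ω)) ∂P := by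
        simp only [L, g, ContinuousLinearMap.mulLeftRight_apply, Matrix.mul_vecMulVec,
          Matrix.vecMulVec_mul, Matrix.vecMul_transpose]
    _ = averagedConj μ Q R (crossMoment U V P) := by rw [hfactor, hmean]; rfl

end SecondMoments

lemma covMat_add_apply {Ω : Type*} [MeasurableSpace Ω] {P : Measure Ω} [IsFiniteMeasure P] {m : ℕ}
    {U V : Ω → Fin m → ℝ} (hU : MemLp U 2 P) (hV : MemLp V 2 P) (i j : Fin m) :
    covMat (U + V) P i j =
      covariance (fun ω => U ω i) (fun ω => U ω j) P +
        covariance (fun ω => U ω i) (fun ω => V ω j) P +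
        (covariance (fun ω => U ω j) (fun ω => V ω i) P + covMat V P i j) := by
  rw [memLp_pi_iff] at hU hV
  rw [covariance_comm (fun ω => U ω j), covMat, Matrix.of_apply, covMat, Matrix.of_apply,
    ← covariance_add_right (hU i) (hU j) (hV j), ← covariance_add_right (hV i) (hU j) (hV j),
    ← covariance_add_left (hU i) (hV i) ((hU j).add (hV j))]
  rfl

/-- Random vectors generated by `e (k + 1) = Q (δ k) *ᵥ e k + R (δ k) *ᵥ b`, where `δ k` has law
`μ` and is independent of the current state `e k` and the forcing vector `b`. The vector `b` does
not change along the recursion, so all the `e k` may depend on it. -/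
structure IsRandomAffineRecursion {Ω κ n : Type*} [MeasurableSpace Ω] [MeasurableSpace κ]
    [Fintype n] (P : Measure Ω) (μ : Measure κ) (Q R : κ → Matrix n n ℝ) (δ : ℕ → Ω → κ)
    (e : ℕ → Ω → n → ℝ) (b : Ω → n → ℝ) : Prop where
  finitelySupported : FinitelySupported μ
  hasLaw (k : ℕ) : HasLaw (δ k) μ P
  indepFun (k : ℕ) : IndepFun (δ k) (fun ω => (e k ω, b ω)) P
  memLp_zero : MemLp (e 0) 2 P
  memLp_forcing : MemLp b 2 P
  succ (k : ℕ) : e (k + 1) = (fun ω => Q (δ k ω) *ᵥ e k ω) + fun ω => R (δ k ω) *ᵥ b ω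

namespace IsRandomAffineRecursion

open scoped MatrixOrder Matrix.Norms.L2Operator

section

variable {Ω κ n : Type*} [MeasurableSpace Ω] [MeasurableSpace κ] [MeasurableSingletonClass κ]
  [Fintype n] {P : Measure Ω} {μ : Measure κ} [IsProbabilityMeasure μ]
  {Q R : κ → Matrix n n ℝ} {δ : ℕ → Ω → κ} {e : ℕ → Ω → n → ℝ} {b : Ω → n → ℝ} {ρ : ℝ}

lemma memLp (h : IsRandomAffineRecursion P μ Q R δ e b) (k : ℕ) : MemLp (e k) 2 P := by
  induction k with
  | zero => exact h.memLp_zero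
  | succ k ih =>
    rw [h.succ k]
    exact (memLp_mulVec (Q := Q) h.finitelySupported (h.hasLaw k) ih).add
      (memLp_mulVec (Q := R) h.finitelySupported (h.hasLaw k) h.memLp_forcing)

variable [DecidableEq n]

lemma crossMoment_succ_left (h : IsRandomAffineRecursion P μ Q R δ e b) (hR : ∫ x, R x ∂μ = 0)
    {g : (n → ℝ) → n → ℝ} (hg : Measurable g) (hgb : MemLp (fun ω => g (b ω)) 2 P) (k : ℕ) :
    crossMoment (e (k + 1)) (fun ω => g (b ω)) P =
      averagedConj μ Q 1 (crossMoment (e k) (fun ω => g (b ω)) P) := by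
  have hμ := h.finitelySupported
  have hind_state : IndepFun (δ k) (fun ω => (e k ω, g (b ω))) P :=
    (h.indepFun k).comp measurable_id (measurable_fst.prodMk (hg.comp measurable_snd))
  have hind_forcing : IndepFun (δ k) (fun ω => (b ω, g (b ω))) P :=
    (h.indepFun k).comp measurable_id (measurable_snd.prodMk (hg.comp measurable_snd))
  have hstate := crossMoment_mulVec_mulVec (Q := Q) (R := 1) hμ (h.hasLaw k) (h.memLp k) hgb
    hind_state
  have hforcing := crossMoment_mulVec_mulVec (Q := R) (R := 1) hμ (h.hasLaw k) h.memLp_forcing hgb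
    hind_forcing
  have hzero (N : Matrix n n ℝ) : averagedConj μ R 1 N = 0 := by
    simpa [averagedConj_apply hμ, hR] using
      integral_mul_const_of_integrable (c := N) (hμ.integrable R)
  simp only [Pi.one_apply, Matrix.one_mulVec, hzero] at hstate hforcing
  rw [h.succ k, crossMoment_add_left (memLp_mulVec hμ (h.hasLaw k) (h.memLp k))
    (memLp_mulVec hμ (h.hasLaw k) h.memLp_forcing) hgb, hstate, hforcing, add_zero]

lemma tendsto_crossMoment_forcing [Nonempty n] (h : IsRandomAffineRecursion P μ Q R δ e b)
    (hR : ∫ x, R x ∂μ = 0) (hQ : ∫ x, Q x * (Q x)ᵀ ∂μ ≤ ρ • 1) (hρ : ρ < 1)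
    {g : (n → ℝ) → n → ℝ} (hg : Measurable g) (hgb : MemLp (fun ω => g (b ω)) 2 P) :
    Tendsto (fun k => crossMoment (e k) (fun ω => g (b ω)) P) atTop (𝓝 0) := by
  have hnorm : ‖averagedConj μ Q 1‖ ≤ (ρ + 1) / 2 :=
    norm_averagedConj_le h.finitelySupported hQ (by simp)
  refine tendsto_zero_of_affine_recursion (T := averagedConj μ Q 1) (by linarith)
    tendsto_const_nhds fun k => ?_
  rw [h.crossMoment_succ_left hR hg hgb, add_zero]

lemma crossMoment_succ_self (h : IsRandomAffineRecursion P μ Q R δ e b) (k : ℕ) :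
    crossMoment (e (k + 1)) (e (k + 1)) P =
      averagedConj μ Q Q (crossMoment (e k) (e k) P) +
        (averagedConj μ Q R (crossMoment (e k) b P) +
            averagedConj μ R Q (crossMoment (e k) b P)ᵀ +
          averagedConj μ R R (crossMoment b b P)) := by
  have hμ := h.finitelySupported
  have hQe := memLp_mulVec (Q := Q) hμ (h.hasLaw k) (h.memLp k)
  have hRb := memLp_mulVec (Q := R) hμ (h.hasLaw k) h.memLp_forcing
  have hee : IndepFun (δ k) (fun ω => (e k ω, e k ω)) P :=
    (h.indepFun k).comp measurable_id (measurable_fst.prodMk measurable_fst)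
  have hbe : IndepFun (δ k) (fun ω => (b ω, e k ω)) P :=
    (h.indepFun k).comp measurable_id measurable_swap
  have hbb : IndepFun (δ k) (fun ω => (b ω, b ω)) P :=
    (h.indepFun k).comp measurable_id (measurable_snd.prodMk measurable_snd)
  rw [h.succ k, crossMoment_add_left hQe hRb (hQe.add hRb),
    crossMoment_add_right hQe hQe hRb, crossMoment_add_right hRb hQe hRb,
    crossMoment_mulVec_mulVec hμ (h.hasLaw k) (h.memLp k) (h.memLp k) hee,
    crossMoment_mulVec_mulVec hμ (h.hasLaw k) (h.memLp k) h.memLp_forcing (h.indepFun k),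
    crossMoment_mulVec_mulVec hμ (h.hasLaw k) h.memLp_forcing (h.memLp k) hbe,
    crossMoment_mulVec_mulVec hμ (h.hasLaw k) h.memLp_forcing h.memLp_forcing hbb,
    transpose_crossMoment (h.memLp k) h.memLp_forcing]
  abel

lemma exists_tendsto_crossMoment_self [Nonempty n] (h : IsRandomAffineRecursion P μ Q R δ e b)
    (hR : ∫ x, R x ∂μ = 0) (hQ : ∫ x, Q x * (Q x)ᵀ ∂μ ≤ ρ • 1) (hρ : ρ < 1) :
    ∃ M, 0 ≤ M ∧
      M = ∫ x, Q x * M * (Q x)ᵀ ∂μ + ∫ x, R x * crossMoment b b P * (R x)ᵀ ∂μ ∧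
      Tendsto (fun k => crossMoment (e k) (e k) P) atTop (𝓝 M) := by
  have hμ := h.finitelySupported
  have hnorm : ‖averagedConj μ Q Q‖ < 1 := by linarith [norm_averagedConj_le hμ hQ hQ]
  have hmixed : Tendsto (fun k => crossMoment (e k) b P) atTop (𝓝 0) :=
    h.tendsto_crossMoment_forcing hR hQ hρ measurable_id h.memLp_forcing
  have hinput : Tendsto (fun k => averagedConj μ Q R (crossMoment (e k) b P) +
      averagedConj μ R Q (crossMoment (e k) b P)ᵀ + averagedConj μ R R (crossMoment b b P)) atTop
      (𝓝 (averagedConj μ R R (crossMoment b b P))) := by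
    have hcont : Continuous fun N : Matrix n n ℝ => averagedConj μ Q R N +
        averagedConj μ R Q Nᵀ + averagedConj μ R R (crossMoment b b P) := by fun_prop
    exact (hcont.tendsto' 0 _ (by simp)).comp hmixed
  obtain ⟨M, hfix, hlim⟩ := exists_fixedPoint_tendsto
    (x := fun k => crossMoment (e k) (e k) P) hnorm hinput h.crossMoment_succ_self
  rw [averagedConj_apply hμ, averagedConj_apply hμ] at hfix
  exact ⟨M, ge_of_tendsto' hlim fun k => crossMoment_self_nonneg (e k), hfix, hlim⟩

end

variable {Ω κ : Type*} [MeasurableSpace Ω] [MeasurableSpace κ] [MeasurableSingletonClass κ]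
  {P : Measure Ω} [IsProbabilityMeasure P] {μ : Measure κ} [IsProbabilityMeasure μ] {d : ℕ}
  {Q R : κ → Matrix (Fin d) (Fin d) ℝ} {δ : ℕ → Ω → κ} {e : ℕ → Ω → Fin d → ℝ}
  {b : Ω → Fin d → ℝ} {ρ : ℝ}

lemma tendsto_integral_apply [NeZero d] (h : IsRandomAffineRecursion P μ Q R δ e b)
    (hR : ∫ x, R x ∂μ = 0) (hQ : ∫ x, Q x * (Q x)ᵀ ∂μ ≤ ρ • 1) (hρ : ρ < 1) (i : Fin d) :
    Tendsto (fun k => ∫ ω, e k ω i ∂P) atTop (𝓝 0) := by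
  have := h.tendsto_crossMoment_forcing hR hQ hρ (g := 1) measurable_const (memLp_const 1)
  simpa [crossMoment_apply (h.memLp _) (memLp_const _)] using
    tendsto_pi_nhds.1 (tendsto_pi_nhds.1 this i) i

lemma tendsto_covariance_forcing [NeZero d] (h : IsRandomAffineRecursion P μ Q R δ e b)
    (hR : ∫ x, R x ∂μ = 0) (hQ : ∫ x, Q x * (Q x)ᵀ ∂μ ≤ ρ • 1) (hρ : ρ < 1) (i j : Fin d) :
    Tendsto (fun k => covariance (fun ω => e k ω i) (fun ω => b ω j) P) atTop (𝓝 0) := by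
  have hmixed := tendsto_pi_nhds.1 (tendsto_pi_nhds.1 (h.tendsto_crossMoment_forcing hR hQ hρ
    measurable_id h.memLp_forcing) i) j
  simp only [crossMoment_apply (h.memLp _) h.memLp_forcing, id] at hmixed
  simpa [covariance_eq_sub (memLp_pi_iff.1 (h.memLp _) i) (memLp_pi_iff.1 h.memLp_forcing j)] using
    hmixed.sub ((h.tendsto_integral_apply hR hQ hρ i).mul_const (∫ ω, b ω j ∂P))

theorem exists_tendsto_covMat_add [NeZero d] (h : IsRandomAffineRecursion P μ Q R δ e b)
    (hR : ∫ x, R x ∂μ = 0) (hQ : ∫ x, Q x * (Q x)ᵀ ∂μ ≤ ρ • 1) (hρ : ρ < 1) :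
    ∃ M, 0 ≤ M ∧
      M = ∫ x, Q x * M * (Q x)ᵀ ∂μ + ∫ x, R x * crossMoment b b P * (R x)ᵀ ∂μ ∧
      Tendsto (fun k => covMat (e k + b) P) atTop (𝓝 (M + covMat b P)) := by
  obtain ⟨M, hM, hfix, hlim⟩ := h.exists_tendsto_crossMoment_self hR hQ hρ
  refine ⟨M, hM, hfix, tendsto_pi_nhds.2 fun i => tendsto_pi_nhds.2 fun j => ?_⟩
  have hself : Tendsto (fun k => covariance (fun ω => e k ω i) (fun ω => e k ω j) P) atTop
      (𝓝 (M i j)) := by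
    have hmoment := tendsto_pi_nhds.1 (tendsto_pi_nhds.1 hlim i) j
    simp only [crossMoment_apply (h.memLp _) (h.memLp _)] at hmoment
    simpa [covariance_eq_sub (memLp_pi_iff.1 (h.memLp _) i) (memLp_pi_iff.1 (h.memLp _) j)] using
      hmoment.sub
        ((h.tendsto_integral_apply hR hQ hρ i).mul (h.tendsto_integral_apply hR hQ hρ j))
  simp only [covMat_add_apply (h.memLp _) h.memLp_forcing]
  simpa using (hself.add (h.tendsto_covariance_forcing hR hQ hρ i j)).add
    ((h.tendsto_covariance_forcing hR hQ hρ j i).add_const (covMat b P i j))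

end IsRandomAffineRecursion

section DropoutLaw

open scoped MatrixOrder Matrix.Norms.L2Operator

variable {d : ℕ} {p : unitInterval}

instance instIsProbabilityMeasureDropoutLaw : IsProbabilityMeasure (dropoutLaw d p) := by
  rw [dropoutLaw]
  infer_instance

lemma ae_dropoutLaw_mem (d : ℕ) (p : unitInterval) :
    ∀ᵐ x ∂(dropoutLaw d p), x ∈ Fintype.piFinset fun _ => ({0, 1} : Finset ℝ) := by
  have hcoord : ∀ᵐ t ∂(bernoulliMeasure (1 : ℝ) 0 p), t ∈ ({0, 1} : Finset ℝ) := by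
    have hmeas : MeasurableSet {t : ℝ | t ∉ ({0, 1} : Finset ℝ)} :=
      (Finset.measurableSet _).compl
    refine ae_iff.2 (bernoulliMeasure_apply_of_notMem_of_notMem p hmeas ?_ ?_) <;> simp
  simp only [Fintype.mem_piFinset]
  exact ae_all_iff.2 fun i => (Measure.quasiMeasurePreserving_eval _ i).ae hcoord

lemma finitelySupported_dropoutLaw (d : ℕ) (p : unitInterval) :
    FinitelySupported (dropoutLaw d p) :=
  ⟨_, ae_dropoutLaw_mem d p⟩

lemma integrable_dropoutLaw {E : Type*} [NormedAddCommGroup E] (f : (Fin d → ℝ) → E) :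
    Integrable f (dropoutLaw d p) :=
  (finitelySupported_dropoutLaw d p).integrable f

lemma ae_dropoutLaw_mul_self (d : ℕ) (p : unitInterval) :
    ∀ᵐ x ∂(dropoutLaw d p), x * x = x := by
  filter_upwards [ae_dropoutLaw_mem d p] with x hx
  ext i
  rcases (by simpa using Fintype.mem_piFinset.1 hx i : x i = 0 ∨ x i = 1) with h | h <;> simp [h]

lemma integral_dropoutLaw_comp_eval (f : ℝ → ℝ) (i : Fin d) :
    ∫ x, f (x i) ∂(dropoutLaw d p) = p * f 1 + (1 - p) * f 0 := by
  have hf : Integrable f (bernoulliMeasure 1 0 p) := integrable_bernoulliMeasure _ _ _ _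
  rw [dropoutLaw, integral_comp_eval (μ := fun _ : Fin d => bernoulliMeasure (1 : ℝ) 0 p) hf.1,
    integral_bernoulliMeasure, smul_eq_mul, smul_eq_mul]

lemma integral_dropoutLaw_apply (i : Fin d) : ∫ x, x i ∂(dropoutLaw d p) = p := by
  simpa using integral_dropoutLaw_comp_eval (p := p) id i

lemma iIndepFun_eval_dropoutLaw :
    iIndepFun (fun (i : Fin d) (x : Fin d → ℝ) => x i) (dropoutLaw d p) :=
  iIndepFun_pi (X := fun _ => id) fun _ => aemeasurable_id

lemma integral_dropoutLaw_apply_mul_apply {i j : Fin d} (hij : i ≠ j) :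
    ∫ x, x i * x j ∂(dropoutLaw d p) = p * p := by
  rw [(iIndepFun_eval_dropoutLaw.indepFun hij).integral_fun_mul_eq_mul_integral
    (integrable_dropoutLaw _).1 (integrable_dropoutLaw _).1, integral_dropoutLaw_apply,
    integral_dropoutLaw_apply]

lemma variance_eval_dropoutLaw (i : Fin d) :
    variance (fun x => x i) (dropoutLaw d p) = p * (1 - p) := by
  rw [variance_eq_integral (integrable_dropoutLaw _).1.aemeasurable, integral_dropoutLaw_apply,
    integral_dropoutLaw_comp_eval (fun t => (t - p) ^ 2)]
  ring

lemma integral_sub_sq_dropoutLaw (i : Fin d) :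
    ∫ x, ((p : ℝ) - x i) ^ 2 ∂(dropoutLaw d p) = p * (1 - p) := by
  rw [integral_dropoutLaw_comp_eval (fun t => (p - t) ^ 2)]
  ring

lemma le_integral_sum_mul_sq (s : Finset (Fin d)) (a : Fin d → ℝ) :
    (p : ℝ) * (1 - p) * ∑ j ∈ s, a j ^ 2 ≤
      ∫ x, (∑ j ∈ s, a j * x j) ^ 2 ∂(dropoutLaw d p) := by
  let Z (j : Fin d) (x : Fin d → ℝ) : ℝ := a j * x j
  have hind : iIndepFun Z (dropoutLaw d p) :=
    iIndepFun_eval_dropoutLaw.comp (fun j t => a j * t) fun j => measurable_const_mul (a j)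
  calc (p : ℝ) * (1 - p) * ∑ j ∈ s, a j ^ 2
      = ∑ j ∈ s, variance (Z j) (dropoutLaw d p) := by
        simp only [Z, variance_const_mul, variance_eval_dropoutLaw, Finset.mul_sum, mul_comm]
    _ = variance (∑ j ∈ s, Z j) (dropoutLaw d p) :=
        (IndepFun.variance_sum (fun j _ => (finitelySupported_dropoutLaw d p).memLp _ 2)
          fun i _ j _ hij => hind.indepFun hij).symm
    _ ≤ ∫ x, ((∑ j ∈ s, Z j) ^ 2) x ∂(dropoutLaw d p) :=
        variance_le_expectation_sq (integrable_dropoutLaw _).1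
    _ = ∫ x, (∑ j ∈ s, a j * x j) ^ 2 ∂(dropoutLaw d p) := by
        simp only [Z, Pi.pow_apply, Finset.sum_apply]

lemma integral_sub_sq_mul_sum_sq (i : Fin d) (a : Fin d → ℝ) :
    ∫ x, ((p : ℝ) - x i) ^ 2 * (∑ j ∈ Finset.univ.erase i, a j * x j) ^ 2 ∂(dropoutLaw d p) =
      p * (1 - p) * ∫ x, (∑ j ∈ Finset.univ.erase i, a j * x j) ^ 2 ∂(dropoutLaw d p) := by
  have hind : IndepFun (fun x : Fin d → ℝ => x i)
      (fun x => ∑ j ∈ Finset.univ.erase i, a j * x j) (dropoutLaw d p) := by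
    have hsum : Measurable fun t : Finset.univ.erase i → ℝ =>
        ∑ j : Finset.univ.erase i, a j * t j := by
      fun_prop
    simp only [← Finset.sum_coe_sort (Finset.univ.erase i)]
    exact (iIndepFun_eval_dropoutLaw.indepFun_finset {i} (Finset.univ.erase i) (by simp)
      measurable_pi_apply).comp (measurable_pi_apply ⟨i, Finset.mem_singleton_self i⟩) hsum
  have hind' : IndepFun (fun x : Fin d → ℝ => ((p : ℝ) - x i) ^ 2)
      (fun x => (∑ j ∈ Finset.univ.erase i, a j * x j) ^ 2) (dropoutLaw d p) :=
    hind.comp (φ := fun t => ((p : ℝ) - t) ^ 2) (ψ := fun t => t ^ 2) (by fun_prop) (by fun_prop)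
  rw [hind'.integral_fun_mul_eq_mul_integral (integrable_dropoutLaw _).1
    (integrable_dropoutLaw _).1, integral_sub_sq_dropoutLaw]

lemma integral_diagonal_dropoutLaw :
    ∫ x, Matrix.diagonal x ∂(dropoutLaw d p) = (p : ℝ) • (1 : Matrix (Fin d) (Fin d) ℝ) := by
  ext i j
  rw [integral_matrix_apply (integrable_dropoutLaw _)]
  rcases eq_or_ne i j with rfl | hij
  · simp [integral_dropoutLaw_apply]
  · simp [hij]

lemma integral_diagonal_mul_dropoutLaw (A : Matrix (Fin d) (Fin d) ℝ) :
    ∫ x, Matrix.diagonal x * A ∂(dropoutLaw d p) = (p : ℝ) • A := by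
  rw [integral_mul_const_of_integrable (integrable_dropoutLaw _), integral_diagonal_dropoutLaw,
    smul_one_mul]

lemma integral_diagonal_mul_mul_diagonal_dropoutLaw (A : Matrix (Fin d) (Fin d) ℝ) :
    ∫ x, Matrix.diagonal x * A * Matrix.diagonal x ∂(dropoutLaw d p) = (p : ℝ) • shrink p A := by
  ext i j
  rw [integral_matrix_apply (integrable_dropoutLaw _), Matrix.smul_apply, shrink_apply]
  simp only [Matrix.mul_diagonal, Matrix.diagonal_mul, smul_eq_mul]
  split_ifs with hij
  · subst hij
    simpa using integral_dropoutLaw_comp_eval (p := p) (fun t => t * A i i * t) i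
  · simp only [mul_right_comm _ (A i j), integral_mul_const,
      integral_dropoutLaw_apply_mul_apply hij]
    ring

end DropoutLaw

section DropoutStep

open scoped MatrixOrder Matrix.Norms.L2Operator

variable {d : ℕ} {α : ℝ} {p : unitInterval} {A : Matrix (Fin d) (Fin d) ℝ} {x : Fin d → ℝ}

/-- The linear part `1 - α D A D` of one dropout step with mask `D = diag x` and Gram matrix `A`,
acting on the distance to the minimizer of the marginalized loss. -/
def stepMatrix (α : ℝ) (A : Matrix (Fin d) (Fin d) ℝ) (x : Fin d → ℝ) : Matrix (Fin d) (Fin d) ℝ :=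
  1 - α • (Matrix.diagonal x * A * Matrix.diagonal x)

/-- The centred noise `α (D A_p - D A D)` which one dropout step with mask `D = diag x` and Gram
matrix `A` applies to the minimizer of the marginalized loss. -/
def noiseMatrix (α p : ℝ) (A : Matrix (Fin d) (Fin d) ℝ) (x : Fin d → ℝ) :
    Matrix (Fin d) (Fin d) ℝ :=
  α • (Matrix.diagonal x * shrink p A - Matrix.diagonal x * A * Matrix.diagonal x)

lemma isHermitian_shrink (hA : Aᵀ = A) : (shrink p A).IsHermitian :=
  (transpose_shrink p A).trans (by rw [hA])

lemma integral_noiseMatrix (α : ℝ) (p : unitInterval) (A : Matrix (Fin d) (Fin d) ℝ) :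
    ∫ x, noiseMatrix α p A x ∂(dropoutLaw d p) = 0 := by
  simp only [noiseMatrix]
  rw [integral_smul, integral_sub (integrable_dropoutLaw _) (integrable_dropoutLaw _),
    integral_diagonal_mul_dropoutLaw, integral_diagonal_mul_mul_diagonal_dropoutLaw, sub_self,
    smul_zero]

lemma diagonal_mul_transpose_self (hx : x * x = x) :
    Matrix.diagonal x * (Matrix.diagonal x)ᵀ = Matrix.diagonal x := by
  rw [Matrix.diagonal_transpose, Matrix.diagonal_mul_diagonal']
  exact congrArg Matrix.diagonal hx

lemma diagonal_le_one (hx : x * x = x) : Matrix.diagonal x ≤ 1 := by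
  have hx_le (i : Fin d) : x i ≤ 1 := by
    have := congrFun hx i
    simp only [Pi.mul_apply] at this
    nlinarith [sq_nonneg (x i - 1)]
  rw [Matrix.le_iff, ← Matrix.diagonal_one, Matrix.diagonal_sub]
  exact Matrix.PosSemidef.diagonal fun i => sub_nonneg.2 (hx_le i)

lemma diagonal_mul_mul_diagonal_mul_transpose_self_le (hx : x * x = x)
    (A : Matrix (Fin d) (Fin d) ℝ) :
    (Matrix.diagonal x * A * Matrix.diagonal x) * (Matrix.diagonal x * A * Matrix.diagonal x)ᵀ ≤
      ‖A‖ ^ 2 • Matrix.diagonal x := by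
  set D := Matrix.diagonal x
  calc D * A * D * (D * A * D)ᵀ
      = D * A * D * (D * A)ᵀ := by
        rw [Matrix.transpose_mul (D * A) D, mul_assoc (D * A) D, ← mul_assoc D,
          diagonal_mul_transpose_self hx, ← mul_assoc]
    _ ≤ D * A * 1 * (D * A)ᵀ := mul_mul_transpose_mono _ (diagonal_le_one hx)
    _ = D * (A * Aᵀ) * Dᵀ := by simp only [mul_one, Matrix.transpose_mul, mul_assoc]
    _ ≤ D * (‖A‖ ^ 2 • 1) * Dᵀ := mul_mul_transpose_mono _ (mul_transpose_self_le A)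
    _ = ‖A‖ ^ 2 • D := by
        rw [mul_smul_comm, mul_one, smul_mul_assoc, diagonal_mul_transpose_self hx]

lemma integral_stepMatrix_mul_transpose_self (hA : Aᵀ = A) :
    ∫ x, stepMatrix α A x * (stepMatrix α A x)ᵀ ∂(dropoutLaw d p) =
      1 - (2 * α * p) • shrink p A + α ^ 2 •
        ∫ x, (Matrix.diagonal x * A * Matrix.diagonal x) *
          (Matrix.diagonal x * A * Matrix.diagonal x)ᵀ ∂(dropoutLaw d p) := by
  let B (x : Fin d → ℝ) := Matrix.diagonal x * A * Matrix.diagonal x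
  have hB (x : Fin d → ℝ) : (B x)ᵀ = B x := by simp [B, hA, mul_assoc]
  have hexpand (x : Fin d → ℝ) : stepMatrix α A x * (stepMatrix α A x)ᵀ =
      1 - (2 * α) • B x + α ^ 2 • (B x * (B x)ᵀ) := by
    change (1 - α • B x) * (1 - α • B x)ᵀ = _
    rw [Matrix.transpose_sub, Matrix.transpose_one, Matrix.transpose_smul, hB]
    simp only [sub_mul, mul_sub, one_mul, mul_one, smul_mul_assoc, mul_smul_comm]
    module
  simp only [hexpand]
  rw [integral_add (integrable_dropoutLaw _) (integrable_dropoutLaw _),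
    integral_sub (integrable_dropoutLaw _) (integrable_dropoutLaw _), integral_smul, integral_smul,
    integral_diagonal_mul_mul_diagonal_dropoutLaw, smul_smul]
  simp [B]

lemma integral_stepMatrix_mul_transpose_self_le (hA : Aᵀ = A) (hα : 0 ≤ α) :
    ∫ x, stepMatrix α A x * (stepMatrix α A x)ᵀ ∂(dropoutLaw d p) ≤
      (1 - α * p * (2 * lambdaMin (shrink p A) - α * ‖A‖ ^ 2)) • 1 := by
  let B (x : Fin d → ℝ) := Matrix.diagonal x * A * Matrix.diagonal x
  have hp : (0 : ℝ) ≤ p := p.2.1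
  have hquad : ∫ x, B x * (B x)ᵀ ∂(dropoutLaw d p) ≤ (‖A‖ ^ 2 * p) • 1 := by
    rw [← smul_smul, ← integral_diagonal_dropoutLaw, ← integral_smul]
    refine integral_mono_ae (integrable_dropoutLaw _) (integrable_dropoutLaw _) ?_
    filter_upwards [ae_dropoutLaw_mul_self d p] with x hx
    exact diagonal_mul_mul_diagonal_mul_transpose_self_le hx A
  have hshrink : (2 * α * p) • lambdaMin (shrink p A) • 1 ≤ (2 * α * p) • shrink p A :=
    smul_le_smul_of_nonneg_left (lambdaMin_smul_one_le (isHermitian_shrink hA)) (by positivity)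
  calc _ = 1 - (2 * α * p) • shrink p A + α ^ 2 • ∫ x, B x * (B x)ᵀ ∂(dropoutLaw d p) :=
        integral_stepMatrix_mul_transpose_self hA
    _ ≤ 1 - (2 * α * p) • lambdaMin (shrink p A) • 1 + α ^ 2 • (‖A‖ ^ 2 * p) • 1 :=
        add_le_add (sub_le_sub_left hshrink _) (smul_le_smul_of_nonneg_left hquad (sq_nonneg α))
    _ = (1 - α * p * (2 * lambdaMin (shrink p A) - α * ‖A‖ ^ 2)) • 1 := by module

lemma le_integral_stepMatrix_mul_transpose_self (hA : Aᵀ = A) (hα : 0 ≤ α) :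
    (1 - 2 * α * p * ‖A‖) • 1 ≤
      ∫ x, stepMatrix α A x * (stepMatrix α A x)ᵀ ∂(dropoutLaw d p) := by
  have hp : (0 : ℝ) ≤ p := p.2.1
  have hquad : 0 ≤ ∫ x, (Matrix.diagonal x * A * Matrix.diagonal x) *
      (Matrix.diagonal x * A * Matrix.diagonal x)ᵀ ∂(dropoutLaw d p) :=
    integral_nonneg fun x => (Matrix.posSemidef_self_mul_conjTranspose _).nonneg
  have hshrink : shrink p A ≤ ‖A‖ • 1 :=
    (le_norm_smul_one (isHermitian_shrink hA)).trans (smul_one_le_smul_one (norm_shrink_le p A))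
  calc (1 - 2 * α * p * ‖A‖) • (1 : Matrix (Fin d) (Fin d) ℝ)
      = 1 - (2 * α * p) • ‖A‖ • 1 := by module
    _ ≤ 1 - (2 * α * p) • shrink p A :=
        sub_le_sub_left (smul_le_smul_of_nonneg_left hshrink (by positivity)) _
    _ ≤ _ := by
        rw [integral_stepMatrix_mul_transpose_self hA]
        exact le_add_of_nonneg_right (smul_nonneg (sq_nonneg α) hquad)

lemma transpose_noiseMatrix_mulVec_apply (hx : x * x = x) (α p : ℝ)
    (A : Matrix (Fin d) (Fin d) ℝ) (v : Fin d → ℝ) (i : Fin d) :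
    ((noiseMatrix α p A x)ᵀ *ᵥ v) i =
      α * ((p - x i) * ∑ j ∈ Finset.univ.erase i, A j i * v j * x j) := by
  have hxi : x i * x i = x i := congrFun hx i
  have hdiag : A i i * x i * v i - x i * A i i * x i * v i = 0 := by
    linear_combination -(A i i * v i) * hxi
  simp only [noiseMatrix, Matrix.mulVec, dotProduct, Matrix.transpose_apply, Matrix.smul_apply,
    Matrix.sub_apply, Matrix.mul_diagonal, Matrix.diagonal_mul, shrink_apply, smul_eq_mul]
  rw [← Finset.add_sum_erase _ _ (Finset.mem_univ i), if_pos rfl, Finset.mul_sum, Finset.mul_sum]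
  have hoffdiag (j : Fin d) (hj : j ∈ Finset.univ.erase i) :
      α * (x j * (if j = i then A j j else p * A j i) - x j * A j i * x i) * v j =
        α * ((p - x i) * (A j i * v j * x j)) := by
    rw [if_neg (Finset.ne_of_mem_erase hj)]
    ring
  rw [Finset.sum_congr rfl hoffdiag]
  linear_combination α * hdiag

lemma minOffDiagSq_mul_dotProduct_self_le (hoff : ∀ i, ∃ j, j ≠ i ∧ A i j ≠ 0) (v : Fin d → ℝ) :
    minOffDiagSq A * (v ⬝ᵥ v) ≤ ∑ i, ∑ j ∈ Finset.univ.erase i, (A j i * v j) ^ 2 := by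
  rw [Finset.sum_comm' (s' := fun j => Finset.univ.erase j) (t' := Finset.univ)
    (by simp [eq_comm]), dotProduct, Finset.mul_sum]
  refine Finset.sum_le_sum fun j _ => ?_
  obtain ⟨i, hij, hA⟩ := hoff j
  calc minOffDiagSq A * (v j * v j) ≤ A j i ^ 2 * (v j * v j) := by
        gcongr
        · exact mul_self_nonneg _
        · exact minOffDiagSq_le hij.symm hA
    _ = (A j i * v j) ^ 2 := by ring
    _ ≤ ∑ i ∈ Finset.univ.erase j, (A j i * v j) ^ 2 :=
        Finset.single_le_sum (f := fun i => (A j i * v j) ^ 2) (fun _ _ => sq_nonneg _)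
          (by simpa using hij)

lemma le_integral_noiseMatrix_mul_transpose_self (hoff : ∀ i, ∃ j, j ≠ i ∧ A i j ≠ 0) (α : ℝ) :
    (α ^ 2 * (p * (1 - p)) ^ 2 * minOffDiagSq A) • 1 ≤
      ∫ x, noiseMatrix α p A x * (noiseMatrix α p A x)ᵀ ∂(dropoutLaw d p) := by
  have hp : (0 : ℝ) ≤ p * (1 - p) := mul_nonneg p.2.1 (sub_nonneg.2 p.2.2)
  have hherm :
      (∫ x, noiseMatrix α p A x * (noiseMatrix α p A x)ᵀ ∂(dropoutLaw d p)).IsHermitian := by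
    refine (Matrix.nonneg_iff_posSemidef.1 (integral_nonneg fun x => ?_)).isHermitian
    exact (Matrix.posSemidef_self_mul_conjTranspose _).nonneg
  refine le_of_dotProduct_mulVec_le (isHermitian_smul_one _) hherm fun v => ?_
  rw [dotProduct_smul_one_mulVec, dotProduct_integral_mul_transpose_self_mulVec
    (integrable_dropoutLaw _)]
  let S (i : Fin d) (x : Fin d → ℝ) : ℝ := ∑ j ∈ Finset.univ.erase i, A j i * v j * x j
  calc α ^ 2 * (p * (1 - p)) ^ 2 * minOffDiagSq A * (v ⬝ᵥ v)
      = α ^ 2 * (p * (1 - p)) ^ 2 * (minOffDiagSq A * (v ⬝ᵥ v)) := by ring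
    _ ≤ α ^ 2 * (p * (1 - p)) ^ 2 * ∑ i, ∑ j ∈ Finset.univ.erase i, (A j i * v j) ^ 2 := by
        gcongr
        exact minOffDiagSq_mul_dotProduct_self_le hoff v
    _ = ∑ i, α ^ 2 * (p * (1 - p) *
          (p * (1 - p) * ∑ j ∈ Finset.univ.erase i, (A j i * v j) ^ 2)) := by
        rw [Finset.mul_sum]
        exact Finset.sum_congr rfl fun i _ => by ring
    _ ≤ ∑ i, α ^ 2 * (p * (1 - p) * ∫ x, S i x ^ 2 ∂(dropoutLaw d p)) := by
        gcongr with i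
        exact le_integral_sum_mul_sq _ _
    _ = ∑ i, ∫ x, (α * ((p - x i) * S i x)) ^ 2 ∂(dropoutLaw d p) := by
        refine Finset.sum_congr rfl fun i _ => ?_
        simp only [mul_pow, integral_const_mul, S, integral_sub_sq_mul_sum_sq]
    _ = ∫ x, ((noiseMatrix α p A x)ᵀ *ᵥ v) ⬝ᵥ ((noiseMatrix α p A x)ᵀ *ᵥ v) ∂(dropoutLaw d p) := by
        rw [← integral_finsetSum _ fun i _ => integrable_dropoutLaw _]
        refine integral_congr_ae ?_
        filter_upwards [ae_dropoutLaw_mul_self d p] with x hx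
        simp only [dotProduct, transpose_noiseMatrix_mulVec_apply hx, S, ← sq]

end DropoutStep

section MarginalLoss

open scoped MatrixOrder Matrix.Norms.L2Operator

variable {n d : ℕ} {X : Matrix (Fin n) (Fin d) ℝ} {p : unitInterval} {y : Fin n → ℝ}
  {b : Fin d → ℝ}

lemma marginalLoss_eq (X : Matrix (Fin n) (Fin d) ℝ) (p : unitInterval) (y : Fin n → ℝ)
    (b : Fin d → ℝ) :
    marginalLoss X p y b =
      y ⬝ᵥ y + p * (b ⬝ᵥ shrink p (gram X) *ᵥ b - 2 * ((Xᵀ *ᵥ y) ⬝ᵥ b)) := by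
  let D (x : Fin d → ℝ) := Matrix.diagonal x
  have hexpand (x : Fin d → ℝ) : ∑ i, (y i - (X *ᵥ (D x *ᵥ b)) i) ^ 2 =
      y ⬝ᵥ y - 2 * ((Xᵀ *ᵥ y) ⬝ᵥ D x *ᵥ b) + b ⬝ᵥ (D x * gram X * D x) *ᵥ b := by
    have hcross : (Xᵀ *ᵥ y) ⬝ᵥ D x *ᵥ b = y ⬝ᵥ X *ᵥ (D x *ᵥ b) := by
      rw [Matrix.mulVec_transpose, Matrix.dotProduct_mulVec y]
    have hquad : b ⬝ᵥ (D x * gram X * D x) *ᵥ b =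
        (X *ᵥ (D x *ᵥ b)) ⬝ᵥ (X *ᵥ (D x *ᵥ b)) := by
      simpa [D, gram, mul_assoc, Matrix.mul_assoc] using
        dotProduct_mul_transpose_self_mulVec (X * D x)ᵀ b
    rw [hcross, hquad]
    simp only [dotProduct, Finset.mul_sum, ← Finset.sum_sub_distrib, ← Finset.sum_add_distrib]
    exact Finset.sum_congr rfl fun i _ => by ring
  have hlin : ∫ x, (Xᵀ *ᵥ y) ⬝ᵥ D x *ᵥ b ∂(dropoutLaw d p) = p * ((Xᵀ *ᵥ y) ⬝ᵥ b) := by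
    rw [← dotProduct_integral_mulVec (integrable_dropoutLaw _), integral_diagonal_dropoutLaw]
    simp [Matrix.smul_mulVec]
  have hquad : ∫ x, b ⬝ᵥ (D x * gram X * D x) *ᵥ b ∂(dropoutLaw d p) =
      p * (b ⬝ᵥ shrink p (gram X) *ᵥ b) := by
    rw [← dotProduct_integral_mulVec (integrable_dropoutLaw _),
      integral_diagonal_mul_mul_diagonal_dropoutLaw, Matrix.smul_mulVec, dotProduct_smul,
      smul_eq_mul]
  refine (integral_congr_ae (.of_forall hexpand)).trans ?_
  rw [integral_add (integrable_dropoutLaw _) (integrable_dropoutLaw _),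
    integral_sub (integrable_dropoutLaw _) (integrable_dropoutLaw _), integral_const_mul, hlin,
    hquad, integral_const, probReal_univ, one_smul]
  ring

lemma marginalLoss_eq_add (hb : shrink p (gram X) *ᵥ b = Xᵀ *ᵥ y) (c : Fin d → ℝ) :
    marginalLoss X p y c =
      marginalLoss X p y b + p * ((c - b) ⬝ᵥ shrink p (gram X) *ᵥ (c - b)) := by
  have hsymm : b ⬝ᵥ shrink p (gram X) *ᵥ c = (Xᵀ *ᵥ y) ⬝ᵥ c := by
    rw [Matrix.dotProduct_mulVec, ← Matrix.mulVec_transpose, transpose_shrink, transpose_gram, hb]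
  rw [marginalLoss_eq, marginalLoss_eq, Matrix.mulVec_sub, sub_dotProduct, dotProduct_sub,
    dotProduct_sub, hsymm, hb, dotProduct_comm c (Xᵀ *ᵥ y), dotProduct_comm b (Xᵀ *ᵥ y)]
  ring

lemma shrink_gram_mulVec_marginalMinimizer (hp : 0 < p) (hG : (shrink p (gram X)).PosDef)
    (y : Fin n → ℝ) : shrink p (gram X) *ᵥ marginalMinimizer X p y = Xᵀ *ᵥ y := by
  have hp' : (0 : ℝ) < p := hp
  obtain ⟨b, hb⟩ := (Matrix.mulVec_surjective_iff_isUnit.2 hG.isUnit) (Xᵀ *ᵥ y)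
  have hmin : ∀ c, marginalLoss X p y b ≤ marginalLoss X p y c := fun c => by
    rw [marginalLoss_eq_add hb c]
    exact le_add_of_nonneg_right
      (mul_nonneg hp'.le (hG.posSemidef.dotProduct_mulVec_nonneg (c - b)))
  have hle : marginalLoss X p y (marginalMinimizer X p y) ≤ marginalLoss X p y b :=
    Classical.epsilon_spec (p := fun b => ∀ c, marginalLoss X p y b ≤ marginalLoss X p y c)
      ⟨b, hmin⟩ b
  suffices marginalMinimizer X p y - b = 0 by rw [sub_eq_zero.1 this, hb]
  by_contra hne
  rw [marginalLoss_eq_add hb (marginalMinimizer X p y)] at hle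
  exact hle.not_gt (lt_add_of_pos_right _ (mul_pos hp' (hG.dotProduct_mulVec_pos hne)))

lemma marginalMinimizer_eq (hp : 0 < p) (hG : (shrink p (gram X)).PosDef) (y : Fin n → ℝ) :
    marginalMinimizer X p y = ((shrink p (gram X))⁻¹ * Xᵀ) *ᵥ y := by
  rw [← Matrix.mulVec_mulVec, ← shrink_gram_mulVec_marginalMinimizer hp hG, Matrix.mulVec_mulVec,
    Matrix.nonsing_inv_mul _ ((Matrix.isUnit_iff_isUnit_det _).1 hG.isUnit), Matrix.one_mulVec]

end MarginalLoss

section Covariance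

open scoped MatrixOrder Matrix.Norms.L2Operator

variable {Ω : Type*} [MeasurableSpace Ω] {P : Measure Ω} {n d : ℕ}

lemma memLp_marginalMinimizer {X : Matrix (Fin n) (Fin d) ℝ} {p : unitInterval} (hp : 0 < p)
    (hG : (shrink p (gram X)).PosDef) {Y : Ω → Fin n → ℝ} {q : ENNReal} (hY : MemLp Y q P) :
    MemLp (fun ω => marginalMinimizer X p (Y ω)) q P := by
  simp only [marginalMinimizer_eq hp hG]
  exact (Matrix.mulVecLin ((shrink p (gram X))⁻¹ * Xᵀ)).toContinuousLinearMap.comp_memLp' hY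

lemma covMat_mulVec [IsFiniteMeasure P] {Z : Ω → Fin n → ℝ} (hZ : MemLp Z 2 P)
    (K : Matrix (Fin d) (Fin n) ℝ) :
    covMat (fun ω => K *ᵥ Z ω) P = K * covMat Z P * Kᵀ := by
  ext i j
  have hterm (i : Fin d) (k : Fin n) : MemLp (fun ω => K i k * Z ω k) 2 P :=
    (hZ.eval k).const_mul _
  simp only [covMat, Matrix.of_apply, Matrix.mulVec, dotProduct, Matrix.mul_apply,
    Matrix.transpose_apply, Finset.sum_mul]
  rw [covariance_fun_sum_fun_sum (hterm i) (hterm j), Finset.sum_comm]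
  simp only [covariance_const_mul_left, covariance_const_mul_right]
  exact Finset.sum_congr rfl fun _ _ => Finset.sum_congr rfl fun _ _ => by ring

lemma covMat_le_crossMoment_self [IsProbabilityMeasure P] {Z : Ω → Fin d → ℝ} (hZ : MemLp Z 2 P) :
    covMat Z P ≤ crossMoment Z Z P := by
  let mean (i : Fin d) : ℝ := ∫ ω, Z ω i ∂P
  have hsub : crossMoment Z Z P - covMat Z P = Matrix.vecMulVec mean (star mean) := by
    ext i j
    rw [Matrix.sub_apply, crossMoment_apply hZ hZ, covMat, Matrix.of_apply,
      covariance_eq_sub (hZ.eval i) (hZ.eval j)]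
    simp [mean, Matrix.vecMulVec_apply]
  rw [Matrix.le_iff, hsub]
  exact Matrix.posSemidef_vecMulVec_self_star mean

lemma covMat_const_add [IsProbabilityMeasure P] {Z : Ω → Fin n → ℝ} (hZ : MemLp Z 2 P)
    (c : Fin n → ℝ) : covMat (fun ω => c + Z ω) P = covMat Z P := by
  ext i j
  have hint (i : Fin n) : Integrable (fun ω => Z ω i) P := (hZ.eval i).integrable one_le_two
  simp only [covMat, Matrix.of_apply, Pi.add_apply]
  rw [covariance_const_add_left (hint i), covariance_const_add_right (hint j)]

lemma one_le_sq_norm_smul_inv_mul_transpose {G : Matrix (Fin d) (Fin d) ℝ} (hG : IsUnit G) :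
    1 ≤ ‖G‖ ^ 2 • (G⁻¹ * G⁻¹ᵀ) := by
  have hdet := (Matrix.isUnit_iff_isUnit_det G).1 hG
  have hinv : G⁻¹ * (G * Gᵀ) * G⁻¹ᵀ = 1 := by
    rw [Matrix.nonsing_inv_mul_cancel_left _ _ hdet, ← Matrix.transpose_mul,
      Matrix.nonsing_inv_mul _ hdet, Matrix.transpose_one]
  simpa [hinv] using mul_mul_transpose_mono G⁻¹ (mul_transpose_self_le G)

lemma le_inv_shrink_mul_gram_mul_inv_shrink (X : Matrix (Fin n) (Fin d) ℝ) {p : unitInterval}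
    (hG : IsUnit (shrink p (gram X))) :
    (lambdaMin (gram X) / spectralNorm (gram X) ^ 2) • 1 ≤
      (shrink p (gram X))⁻¹ * gram X * (shrink p (gram X))⁻¹ᵀ := by
  set A := gram X
  set G := shrink p A
  have hl : 0 ≤ lambdaMin A := lambdaMin_nonneg (gram_nonneg X)
  have hnorm : lambdaMin A / ‖A‖ ^ 2 * ‖G‖ ^ 2 ≤ lambdaMin A := by
    rw [div_mul_eq_mul_div]
    refine div_le_of_le_mul₀ (sq_nonneg _) hl ?_
    gcongr
    exact norm_shrink_le p A
  calc (lambdaMin A / ‖A‖ ^ 2) • (1 : Matrix (Fin d) (Fin d) ℝ)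
      ≤ (lambdaMin A / ‖A‖ ^ 2) • ‖G‖ ^ 2 • (G⁻¹ * G⁻¹ᵀ) :=
        smul_le_smul_of_nonneg_left (one_le_sq_norm_smul_inv_mul_transpose hG) (by positivity)
    _ = (lambdaMin A / ‖A‖ ^ 2 * ‖G‖ ^ 2) • (G⁻¹ * G⁻¹ᵀ) := smul_smul _ _ _
    _ ≤ lambdaMin A • (G⁻¹ * G⁻¹ᵀ) :=
        smul_le_smul_of_nonneg_right hnorm (Matrix.posSemidef_self_mul_conjTranspose G⁻¹).nonneg
    _ = G⁻¹ * (lambdaMin A • 1) * G⁻¹ᵀ := by rw [mul_smul_comm, mul_one, smul_mul_assoc]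
    _ ≤ G⁻¹ * A * G⁻¹ᵀ := mul_mul_transpose_mono G⁻¹
        (lambdaMin_smul_one_le (Matrix.nonneg_iff_posSemidef.1 (gram_nonneg X)).isHermitian)

lemma le_crossMoment_marginalMinimizer [IsProbabilityMeasure P] {X : Matrix (Fin n) (Fin d) ℝ}
    {p : unitInterval} (hp : 0 < p) (hG : (shrink p (gram X)).PosDef) {Y : Ω → Fin n → ℝ}
    (hY : MemLp Y 2 P) {s : ℝ} (hs : 0 ≤ s) (hcov : s • 1 ≤ covMat Y P) :
    (s * (lambdaMin (gram X) / spectralNorm (gram X) ^ 2)) • 1 ≤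
      crossMoment (fun ω => marginalMinimizer X p (Y ω)) (fun ω => marginalMinimizer X p (Y ω))
        P := by
  refine le_trans ?_ (covMat_le_crossMoment_self (memLp_marginalMinimizer hp hG hY))
  simp only [marginalMinimizer_eq hp hG]
  set G := shrink p (gram X)
  let K : Matrix (Fin d) (Fin n) ℝ := G⁻¹ * Xᵀ
  have hK : K * Kᵀ = G⁻¹ * gram X * G⁻¹ᵀ := by
    simp only [K, gram, Matrix.transpose_mul, Matrix.transpose_transpose, Matrix.mul_assoc]
  calc (s * (lambdaMin (gram X) / spectralNorm (gram X) ^ 2)) • (1 : Matrix (Fin d) (Fin d) ℝ)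
      = s • (lambdaMin (gram X) / spectralNorm (gram X) ^ 2) • 1 := (smul_smul _ _ _).symm
    _ ≤ s • (K * Kᵀ) := smul_le_smul_of_nonneg_left
        (hK ▸ le_inv_shrink_mul_gram_mul_inv_shrink X hG.isUnit) hs
    _ = K * (s • (1 : Matrix (Fin n) (Fin n) ℝ)) * Kᵀ := by simp
    _ ≤ K * covMat Y P * Kᵀ := mul_mul_transpose_mono K hcov
    _ = covMat (fun ω => K *ᵥ Y ω) P := (covMat_mulVec hY K).symm

end Covariance

section Iterates

variable {n d : ℕ}

lemma continuous_iterate {T : Type*} [TopologicalSpace T] (X : Matrix (Fin n) (Fin d) ℝ) (α : ℝ)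
    {y : T → Fin n → ℝ} {b₀ : T → Fin d → ℝ} {δ : T → ℕ → Fin d → ℝ} (hy : Continuous y)
    (hb₀ : Continuous b₀) (hδ : Continuous δ) (k : ℕ) :
    Continuous fun t => iterate X α (y t) (b₀ t) (δ t) k := by
  induction k with
  | zero => exact hb₀
  | succ k ih =>
    simp only [iterate]
    fun_prop

lemma iterate_congr (X : Matrix (Fin n) (Fin d) ℝ) (α : ℝ) (y : Fin n → ℝ) (b₀ : Fin d → ℝ)
    {δ δ' : ℕ → Fin d → ℝ} {k : ℕ} (h : ∀ i < k, δ i = δ' i) :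
    iterate X α y b₀ δ k = iterate X α y b₀ δ' k := by
  induction k with
  | zero => rfl
  | succ k ih =>
    simp only [iterate, ih fun i hi => h i (hi.trans k.lt_succ_self), h k k.lt_succ_self]

lemma iterate_succ_sub (X : Matrix (Fin n) (Fin d) ℝ) (α p : ℝ) {y : Fin n → ℝ}
    {b : Fin d → ℝ} (hb : shrink p (gram X) *ᵥ b = Xᵀ *ᵥ y) (b₀ : Fin d → ℝ)
    (δ : ℕ → Fin d → ℝ) (k : ℕ) :
    iterate X α y b₀ δ (k + 1) - b =
      stepMatrix α (gram X) (δ k) *ᵥ (iterate X α y b₀ δ k - b) +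
        noiseMatrix α p (gram X) (δ k) *ᵥ b := by
  have hgram (v : Fin d → ℝ) : gram X *ᵥ v = Xᵀ *ᵥ (X *ᵥ v) := by
    rw [gram, Matrix.mulVec_mulVec]
  simp only [iterate, stepMatrix, noiseMatrix, Matrix.mulVec_sub, Matrix.sub_mulVec,
    Matrix.smul_mulVec, Matrix.one_mulVec, ← Matrix.mulVec_mulVec, hb, hgram, smul_sub]
  abel

lemma indepFun_prodMk_right_of_indepFun {Ω S T U : Type*} [MeasurableSpace Ω] [MeasurableSpace S]
    [MeasurableSpace T] [MeasurableSpace U] {P : Measure Ω} [IsProbabilityMeasure P]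
    {f : Ω → S} {g : Ω → T} {h : Ω → U} (hf : Measurable f) (hg : Measurable g)
    (hh : Measurable h) (hfg : IndepFun f g P) (hfgh : IndepFun (fun ω => (f ω, g ω)) h P) :
    IndepFun f (fun ω => (g ω, h ω)) P := by
  have hgh : IndepFun g h P := hfgh.comp measurable_snd measurable_id
  have := Measure.isProbabilityMeasure_map (μ := P) hf.aemeasurable
  have := Measure.isProbabilityMeasure_map (μ := P) hg.aemeasurable
  have := Measure.isProbabilityMeasure_map (μ := P) hh.aemeasurable
  rw [indepFun_iff_map_prod_eq_prod_map_map hf.aemeasurable (hg.prodMk hh).aemeasurable,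
    (indepFun_iff_map_prod_eq_prod_map_map hg.aemeasurable hh.aemeasurable).1 hgh,
    ← Measure.prodAssoc_prod, ← (indepFun_iff_map_prod_eq_prod_map_map hf.aemeasurable
      hg.aemeasurable).1 hfg, ← (indepFun_iff_map_prod_eq_prod_map_map
      (hf.prodMk hg).aemeasurable hh.aemeasurable).1 hfgh,
    Measure.map_map MeasurableEquiv.prodAssoc.measurable ((hf.prodMk hg).prodMk hh)]
  rfl

lemma indepFun_iterate {Ω : Type*} [MeasurableSpace Ω] {P : Measure Ω} [IsProbabilityMeasure P]
    (X : Matrix (Fin n) (Fin d) ℝ) (α : ℝ) {Y : Ω → Fin n → ℝ} {β₀ : Ω → Fin d → ℝ}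
    {δ : ℕ → Ω → Fin d → ℝ} (hY : Measurable Y) (hβ₀ : Measurable β₀)
    (hδ : ∀ k, Measurable (δ k)) (hδ_iindep : iIndepFun δ P)
    (hδ_indep : IndepFun (fun ω k => δ k ω) (fun ω => (β₀ ω, Y ω)) P) (k : ℕ) :
    IndepFun (δ k) (fun ω => (iterate X α (Y ω) (β₀ ω) (fun i => δ i ω) k, Y ω)) P := by
  let past (ω : Ω) (i : Finset.range k) : Fin d → ℝ := δ i ω
  have hind_past : IndepFun (δ k) past P :=
    (hδ_iindep.indepFun_finset {k} (Finset.range k) (by simp) hδ).comp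
      (φ := fun x : ({k} : Finset ℕ) → Fin d → ℝ => x ⟨k, Finset.mem_singleton_self k⟩)
      (measurable_pi_apply _) measurable_id
  have hind_data : IndepFun (fun ω => (δ k ω, past ω)) (fun ω => (β₀ ω, Y ω)) P :=
    hδ_indep.comp (φ := fun x : ℕ → Fin d → ℝ => (x k, fun i : Finset.range k => x i))
      (by fun_prop) measurable_id
  have hpast : Measurable past := measurable_pi_iff.2 fun i => hδ i
  have hind := indepFun_prodMk_right_of_indepFun (hδ k) hpast (hβ₀.prodMk hY) hind_past hind_data
  let extend (x : Finset.range k → Fin d → ℝ) (i : ℕ) : Fin d → ℝ :=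
    if h : i ∈ Finset.range k then x ⟨i, h⟩ else 0
  have hextend : Continuous extend := continuous_pi fun i => by
    by_cases h : i ∈ Finset.range k
    · simpa only [extend, dif_pos h] using continuous_apply _
    · simpa only [extend, dif_neg h] using continuous_const
  let readout (z : (Finset.range k → Fin d → ℝ) × (Fin d → ℝ) × (Fin n → ℝ)) :=
    (iterate X α z.2.2 z.2.1 (extend z.1) k, z.2.2)
  have hreadout : Continuous readout :=
    (continuous_iterate X α (by fun_prop) (by fun_prop) (by fun_prop) k).prodMk (by fun_prop)
  have heq : (fun ω => (iterate X α (Y ω) (β₀ ω) (fun i => δ i ω) k, Y ω)) =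
      readout ∘ fun ω => (past ω, β₀ ω, Y ω) := by
    funext ω
    refine Prod.ext (iterate_congr X α _ _ fun i hi => ?_) rfl
    simp [extend, past, hi]
  rw [heq]
  exact hind.comp measurable_id hreadout.measurable

variable {Ω : Type*} [MeasurableSpace Ω] {P : Measure Ω} [IsProbabilityMeasure P]

lemma isRandomAffineRecursion_iterate {X : Matrix (Fin n) (Fin d) ℝ} {p : unitInterval} (hp : 0 < p)
    (hG : (shrink p (gram X)).PosDef) (α : ℝ) {Y : Ω → Fin n → ℝ} {β₀ : Ω → Fin d → ℝ}
    {δ : ℕ → Ω → Fin d → ℝ} (hY : Measurable Y) (hY_sq : MemLp Y 2 P) (hβ₀ : Measurable β₀)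
    (hβ₀_sq : MemLp β₀ 2 P) (hδ : ∀ k, Measurable (δ k))
    (hδ_law : ∀ k, P.map (δ k) = dropoutLaw d p) (hδ_iindep : iIndepFun δ P)
    (hδ_indep : IndepFun (fun ω k => δ k ω) (fun ω => (β₀ ω, Y ω)) P) :
    IsRandomAffineRecursion P (dropoutLaw d p) (stepMatrix α (gram X)) (noiseMatrix α p (gram X)) δ
      (fun k ω => iterate X α (Y ω) (β₀ ω) (fun i => δ i ω) k - marginalMinimizer X p (Y ω))
      fun ω => marginalMinimizer X p (Y ω) where
  finitelySupported := finitelySupported_dropoutLaw d p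
  hasLaw k := ⟨(hδ k).aemeasurable, hδ_law k⟩
  indepFun k := by
    have hmeas : Measurable (marginalMinimizer X p) := by
      simp only [funext (marginalMinimizer_eq hp hG)]
      exact Continuous.measurable (by fun_prop)
    exact (indepFun_iterate X α hY hβ₀ hδ hδ_iindep hδ_indep k).comp measurable_id
      (ψ := fun z => (z.1 - marginalMinimizer X p z.2, marginalMinimizer X p z.2))
      (by fun_prop)
  memLp_zero := hβ₀_sq.sub (memLp_marginalMinimizer hp hG hY_sq)
  memLp_forcing := memLp_marginalMinimizer hp hG hY_sq
  succ k := funext fun ω => iterate_succ_sub X α p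
    (shrink_gram_mulVec_marginalMinimizer hp hG (Y ω)) (β₀ ω) (fun i => δ i ω) k

end Iterates

section StationaryLowerBound

open scoped MatrixOrder Matrix.Norms.L2Operator

variable {d : ℕ} {α : ℝ} {p : unitInterval} {A : Matrix (Fin d) (Fin d) ℝ}

lemma pos_and_pos_of_div_sq_pos {x y : ℝ} (hy : 0 ≤ y) (h : 0 < x / y ^ 2) : 0 < x ∧ 0 < y := by
  rcases hy.eq_or_lt with rfl | hy
  · simp at h
  · exact ⟨(div_pos_iff_of_pos_right (by positivity)).1 h, hy⟩

lemma neZero_of_lambdaMin_pos (hA : 0 < lambdaMin A) : NeZero d := by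
  refine ⟨?_⟩
  rintro rfl
  simp [lambdaMin, spectrum.of_subsingleton] at hA

lemma le_integral_noiseMatrix_mul_mul_transpose (hoff : ∀ i, ∃ j, j ≠ i ∧ A i j ≠ 0) (α : ℝ)
    {S : Matrix (Fin d) (Fin d) ℝ} {s : ℝ} (hs : 0 ≤ s) (hS : s • 1 ≤ S) :
    (s * (α ^ 2 * (p * (1 - p)) ^ 2 * minOffDiagSq A)) • 1 ≤
      ∫ x, noiseMatrix α p A x * S * (noiseMatrix α p A x)ᵀ ∂(dropoutLaw d p) :=
  calc (s * (α ^ 2 * (p * (1 - p)) ^ 2 * minOffDiagSq A)) • (1 : Matrix (Fin d) (Fin d) ℝ)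
      = s • (α ^ 2 * (p * (1 - p)) ^ 2 * minOffDiagSq A) • 1 := (smul_smul _ _ _).symm
    _ ≤ s • ∫ x, noiseMatrix α p A x * (noiseMatrix α p A x)ᵀ ∂(dropoutLaw d p) :=
        smul_le_smul_of_nonneg_left (le_integral_noiseMatrix_mul_transpose_self hoff α) hs
    _ = ∫ x, noiseMatrix α p A x * (s • 1) * (noiseMatrix α p A x)ᵀ ∂(dropoutLaw d p) :=
        (integral_mul_smul_one_mul_transpose _ _).symm
    _ ≤ ∫ x, noiseMatrix α p A x * S * (noiseMatrix α p A x)ᵀ ∂(dropoutLaw d p) :=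
        integral_mul_mul_transpose_mono (finitelySupported_dropoutLaw d p) hS

lemma smul_one_le_of_eq_integral_stepMatrix_add [NeZero d] (hA : Aᵀ = A) (hα : 0 < α) (hp : 0 < p)
    (hA_norm : 0 < spectralNorm A) (hoff : ∀ i, ∃ j, j ≠ i ∧ A i j ≠ 0)
    {M S : Matrix (Fin d) (Fin d) ℝ} (hM : 0 ≤ M)
    (hfix : M = ∫ x, stepMatrix α A x * M * (stepMatrix α A x)ᵀ ∂(dropoutLaw d p) +
      ∫ x, noiseMatrix α p A x * S * (noiseMatrix α p A x)ᵀ ∂(dropoutLaw d p))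
    {s : ℝ} (hs : 0 ≤ s) (hS : s • 1 ≤ S) :
    (s * (α * p * (1 - p) ^ 2 / (2 * spectralNorm A)) * minOffDiagSq A) • 1 ≤ M := by
  have hp' : (0 : ℝ) < p := hp
  have hθ : 0 < 2 * α * p * ‖A‖ := mul_pos (by positivity) hA_norm
  have h := smul_one_le_of_eq_integral_add (finitelySupported_dropoutLaw d p) hθ hM hfix
    (le_integral_noiseMatrix_mul_mul_transpose hoff α hs hS)
    (le_integral_stepMatrix_mul_transpose_self hA hα.le)
  convert h using 2
  rw [spectralNorm_eq_norm] at hA_norm ⊢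
  field_simp

lemma smul_one_le_of_eq_integral_add_crossMoment_marginalMinimizer {Ω : Type*} [MeasurableSpace Ω]
    {P : Measure Ω} [IsProbabilityMeasure P] {n : ℕ} [NeZero d] {X : Matrix (Fin n) (Fin d) ℝ}
    (hα : 0 < α) (hp : 0 < p) (hnorm : 0 < spectralNorm (gram X))
    (hG : (shrink p (gram X)).PosDef) (hoff : ∀ i, ∃ j, j ≠ i ∧ gram X i j ≠ 0)
    {Y : Ω → Fin n → ℝ} (hY : MemLp Y 2 P) {s : ℝ} (hs : 0 ≤ s) (hcov : s • 1 ≤ covMat Y P)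
    {M : Matrix (Fin d) (Fin d) ℝ} (hM : 0 ≤ M)
    (hfix : M = ∫ x, stepMatrix α (gram X) x * M * (stepMatrix α (gram X) x)ᵀ ∂(dropoutLaw d p) +
      ∫ x, noiseMatrix α p (gram X) x *
        crossMoment (fun ω => marginalMinimizer X p (Y ω))
          (fun ω => marginalMinimizer X p (Y ω)) P *
        (noiseMatrix α p (gram X) x)ᵀ ∂(dropoutLaw d p)) :
    (s * (α * p * (1 - p) ^ 2 * lambdaMin (gram X)) / (2 * spectralNorm (gram X) ^ 3) *
      minOffDiagSq (gram X)) • 1 ≤ M := by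
  have hl : 0 ≤ lambdaMin (gram X) := lambdaMin_nonneg (gram_nonneg X)
  have h := smul_one_le_of_eq_integral_stepMatrix_add (transpose_gram X) hα hp hnorm hoff hM hfix
    (by positivity) (le_crossMoment_marginalMinimizer hp hG hY hs hcov)
  convert h using 2
  ring

end StationaryLowerBound

end

end Dropout

theorem mainTheorem2_general {Ω : Type*} [MeasurableSpace Ω] (P : Measure Ω)
    [IsProbabilityMeasure P] {n d : ℕ} (X : Matrix (Fin n) (Fin d) ℝ) (Y : Ω → Fin n → ℝ)
    (hY_meas : Measurable Y) (hY_sq : MemLp Y 2 P) (σ : ℝ)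
    (hY_cov : (Dropout.covMat Y P - σ ^ 2 • (1 : Matrix (Fin n) (Fin n) ℝ)).PosSemidef)
    (β₀ : Ω → Fin d → ℝ) (hβ₀_meas : Measurable β₀) (hβ₀_sq : MemLp β₀ 2 P)
    (p : unitInterval) (hp : 0 < p) (δ : ℕ → Ω → Fin d → ℝ) (hδ_meas : ∀ k, Measurable (δ k))
    (hδ_law : ∀ k, P.map (δ k) = Dropout.dropoutLaw d p) (hδ_iindep : iIndepFun δ P)
    (hδ_indep : IndepFun (fun ω k => δ k ω) (fun ω => (β₀ ω, Y ω)) P) (α : ℝ) (hα : 0 < α)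
    (hα2 : α < 2 * Dropout.lambdaMin (Dropout.shrink p (Dropout.gram X)) /
      Dropout.spectralNorm (Dropout.gram X) ^ 2)
    (hoff : ∀ l, ∃ m, m ≠ l ∧ Dropout.gram X l m ≠ 0) :
    ∃ L : Matrix (Fin d) (Fin d) ℝ,
      Tendsto
        (fun k => Dropout.covMat
          (fun ω => Dropout.iterate X α (Y ω) (β₀ ω) (fun i => δ i ω) k) P)
        atTop (𝓝 L) ∧
      ((L - Dropout.covMat (fun ω => Dropout.marginalMinimizer X p (Y ω)) P) -
        (σ ^ 2 * (α * p * (1 - p) ^ 2 * Dropout.lambdaMin (Dropout.gram X)) /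
            (2 * Dropout.spectralNorm (Dropout.gram X) ^ 3) *
          Dropout.minOffDiagSq (Dropout.gram X)) •
          (1 : Matrix (Fin d) (Fin d) ℝ)).PosSemidef := by
  have hA := Dropout.transpose_gram X
  have hp_pos : (0 : ℝ) < p := hp
  obtain ⟨hlam, hnorm⟩ : 0 < 2 * Dropout.lambdaMin (Dropout.shrink p (Dropout.gram X)) ∧
      0 < Dropout.spectralNorm (Dropout.gram X) :=
    Dropout.pos_and_pos_of_div_sq_pos (norm_nonneg _) (hα.trans hα2)
  replace hlam : 0 < Dropout.lambdaMin (Dropout.shrink p (Dropout.gram X)) := by linarith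
  have := Dropout.neZero_of_lambdaMin_pos hlam
  have hG : (Dropout.shrink p (Dropout.gram X)).PosDef := Dropout.posDef_of_smul_one_le hlam
    (Dropout.lambdaMin_smul_one_le (Dropout.isHermitian_shrink hA))
  have hrate : 1 - α * p * (2 * Dropout.lambdaMin (Dropout.shrink p (Dropout.gram X)) -
      α * Dropout.spectralNorm (Dropout.gram X) ^ 2) < 1 := by
    rw [lt_div_iff₀ (by positivity)] at hα2
    exact sub_lt_self _ (mul_pos (by positivity) (sub_pos.2 hα2))
  obtain ⟨M, hM, hfix, hlim⟩ :=
    (Dropout.isRandomAffineRecursion_iterate hp hG α hY_meas hY_sq hβ₀_meas hβ₀_sq hδ_meas hδ_law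
      hδ_iindep hδ_indep).exists_tendsto_covMat_add (Dropout.integral_noiseMatrix α p _)
      (Dropout.integral_stepMatrix_mul_transpose_self_le hA hα.le) hrate
  refine ⟨_, by simpa only [Pi.add_def, sub_add_cancel] using hlim, ?_⟩
  rw [add_sub_cancel_right]
  exact Dropout.smul_one_le_of_eq_integral_add_crossMoment_marginalMinimizer hα hp hnorm hG hoff
    hY_sq (sq_nonneg σ) hY_cov hM hfix

theorem mainTheorem2 {Ω : Type*} [MeasurableSpace Ω] (P : Measure Ω) [IsProbabilityMeasure P]
    {n d : ℕ} (X : Matrix (Fin n) (Fin d) ℝ)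
    -- the linear regression model `Y = X β⋆ + ε`
    (βstar : Fin d → ℝ) (ε Y : Ω → Fin n → ℝ)
    (hε_meas : Measurable ε)
    (hε_sq : ∀ i, MemLp (fun ω => ε ω i) 2 P)
    (hε_mean : ∀ i, ∫ ω, ε ω i ∂P = 0)
    (hε_cov : Dropout.covMat ε P = 1)
    (hY : ∀ ω, Y ω = X *ᵥ βstar + ε ω)
    -- the model is in reduced form: `X` has no zero column
    (hX : ∀ j, ∃ i, X i j ≠ 0)
    -- the square integrable initialization, independent of the data
    (β₀ : Ω → Fin d → ℝ)
    (hβ₀_meas : Measurable β₀)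
    (hβ₀_sq : ∀ j, MemLp (fun ω => β₀ ω j) 2 P)
    (hβ₀_indep : IndepFun β₀ Y P)
    -- i.i.d. `p`-dropout matrices `D₁, D₂, …`, given by their diagonals `δ 0, δ 1, …` and
    -- independent of the initialization and the data
    (p : unitInterval) (hp0 : 0 < p) (hp1 : p < 1)
    (δ : ℕ → Ω → Fin d → ℝ)
    (hδ_meas : ∀ k, Measurable (δ k))
    (hδ_law : ∀ k, P.map (δ k) = Dropout.dropoutLaw d p)
    (hδ_iindep : iIndepFun δ P)
    (hδ_indep : IndepFun (fun ω k => δ k ω) (fun ω => (β₀ ω, Y ω)) P)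
    -- the learning rate
    (α : ℝ) (hα : 0 < α)
    (hα1 : α * p * Dropout.spectralNorm (Dropout.gram X) < 1)
    (hα2 : α < Dropout.lambdaMin (Dropout.shrink p (Dropout.gram X)) /
      (3 * Dropout.spectralNorm (Dropout.gram X) ^ 2))
    -- every row of the Gram matrix has a nonzero off-diagonal entry
    (hoff : ∀ l, ∃ m, m ≠ l ∧ Dropout.gram X l m ≠ 0) :
    ∃ L : Matrix (Fin d) (Fin d) ℝ,
      Tendsto
        (fun k => Dropout.covMat
          (fun ω => Dropout.iterate X α (Y ω) (β₀ ω) (fun i => δ i ω) k) P)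
        atTop (𝓝 L) ∧
      ((L - Dropout.covMat (fun ω => Dropout.marginalMinimizer X p (Y ω)) P) -
        ((α * p * (1 - p) ^ 2 * Dropout.lambdaMin (Dropout.gram X)) /
            (2 * Dropout.spectralNorm (Dropout.gram X) ^ 3) *
          Dropout.minOffDiagSq (Dropout.gram X)) •
          (1 : Matrix (Fin d) (Fin d) ℝ)).PosSemidef := by
  have hY_eq : Y = fun ω => X *ᵥ βstar + ε ω := funext hY
  have hε : MemLp ε 2 P := memLp_pi_iff.2 hε_sq
  have hY_meas : Measurable Y := hY_eq ▸ hε_meas.const_add _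
  have hY_sq : MemLp Y 2 P := hY_eq ▸ (memLp_const (X *ᵥ βstar)).add hε
  have hY_cov : Dropout.covMat Y P = 1 := by rw [hY_eq, Dropout.covMat_const_add hε, hε_cov]
  have hα2' : α < 2 * Dropout.lambdaMin (Dropout.shrink p (Dropout.gram X)) /
      Dropout.spectralNorm (Dropout.gram X) ^ 2 := by
    rw [mul_comm 3, ← div_div] at hα2
    rw [mul_div_assoc]
    linarith
  simpa only [one_pow, one_mul] using mainTheorem2_general P X Y hY_meas hY_sq 1
    (by simp [hY_cov, Matrix.PosSemidef.zero]) β₀ hβ₀_meas (memLp_pi_iff.2 hβ₀_sq) p hp0 δ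
    hδ_meas hδ_law hδ_iindep hδ_indep α hα hα2' hoff
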